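/- Let $f,g:\mathbb R^{d_x}\times\mathbb R^{d_y}\to\mathbb R$ be continuously differentiable and $h(x,y)=Bx+Ay-b$ with $B\in\mathbb R^{d_h\times d_x}$, $A\in\mathbb R^{d_h\times d_y}$ of full row rank, $b\in\mathbb R^{d_h}$. Put $\mathcal Y(x)=\{y: h(x,y)\le 0\}$, $y^*(x)=z^*(x)=\arg\min_{y\in\mathcal Y(x)}g(x,y)$, $\Phi(x)=f(x,y^*(x))$ and, for $\delta>0$, $y^*_\delta(x)=\arg\min_{y\in\mathcal Y(x)}\{\delta f(x,y)+g(x,y)\}$ and $$\Phi_\delta(x)=\min_{y\in\mathcal Y(x)}\max_{z\in\mathcal Y(x)}\Big[f(x,y)+\tfrac1\delta\big(g(x,y)-g(x,z)\big)\Big]=f(x,y^*_\delta(x))+\tfrac1\delta\big[g(x,y^*_\delta(x))-g(x,y^*(x))\big].$$ Assume that $\Phi$ is bounded below; that $f$ is $l_{f,0}$-Lipschitz on $\{(x,y):y\in\mathcal Y(x)\}$; that $\nabla f$ and $\nabla g$ are Lipschitz on $\mathbb R^{d_x}\times\mathbb R^{d_y}$ with constants $l_{f,1}$ and $l_{g,1}$;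 and that for each $x$ the function $g(x,\cdot)$ is $\mu_g$-strongly convex on $\mathbb R^{d_y}$, $\mu_g>0$. Let $v^*(x)=\arg\max_{v\ge0}\min_{z\in\mathbb R^{d_y}}\{g(x,z)+v^\top h(x,z)\}$. **Projected gradient (PGD)** for $\max_{v\ge0}\min_z g(x_0,z)+v^\top h(x_0,z)$ at a fixed $x_0$, with step sizes $\tau_z,\tau_v$: $z\leftarrow z-\tau_z(\nabla_y g(x_0,z)+A^\top v)$, then $v\leftarrow \Pi_{+}(v+\tau_v h(x_0,z))$ with the new $z$. **SFLCB.** For $y'=(y,\alpha)$, $z'=(z,\beta)$ let $$K(x,y',z',u,v)=\delta f(x,y)+g(x,y)-g(x,z)+u^\top(h(x,y)-\alpha)-v^\top(h(x,z)-\beta)+\tfrac{\rho_1}2\|h(x,y)-\alpha\|^2-\tfrac{\rho_2}2\|h(x,z)-\beta\|^2 .$$ One iteration sets $u_{t+1}=u_t+\eta_u(h(x_t,y_t)-\alpha_t)$, $v_{t+1}=v_t+\eta_v(h(x_t,z_t)-\beta_t)$ and then, with the gradients of $K$ at $(x_t,y'_t,z'_t,u_{t+1},v_{t+1})$, $x_{t+1}=x_t-\eta_x\nabla_xK$,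 $y'_{t+1}=\Pi(y'_t-\eta_y\nabla_{y'}K)$, $z'_{t+1}=\Pi(z'_t+\eta_z\nabla_{z'}K)$, where $\Pi$ projects the slack component ($\alpha$, resp. $\beta$) onto the nonpositive orthant and leaves the other component unchanged. The complexity of a run is the number of evaluations of $\nabla f$ and $\nabla g$ that it makes. **Claim.** Let $\|A\|$ be the spectral norm and let $\rho_1,\rho_2>0$ satisfy $\rho_1\|A\|^2<\mu_g/2$ and $\rho_2\|A\|^2<\mu_g$. There are step sizes $\tau_z,\tau_v,\eta_x,\eta_y,\eta_z,\eta_u,\eta_v>0$, depending only on $A,B,\mu_g,l_{f,1},l_{g,1},\rho_1,\rho_2$, such that for all $f,g,b$ as above, every $x_0\in\mathbb R^{d_x}$, every start $(z,v)$ of PGD with $v\ge0$, and all $0<c_1\le c_2$, there are constants $C_1,C_2,C_3>0$, independent of $\varepsilon$ and $\delta$, with the following property. For every $\varepsilon\in(0,1/2]$ and every $\delta$ with $c_1\varepsilon\le\delta\le c_2\varepsilon$ and $2l_{f,1}\delta\le\mu_g$, the points $y^*(x)$, $y^*_\delta(x)$ (for all $x$) and $v^*(x_0)$ exist and are unique,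 and: 1. $\lceil C_1\log(1/\varepsilon)\rceil$ iterations of PGD produce $\hat z,\hat v$ with $\|\hat z-z^*(x_0)\|\le\delta$ and $\|\hat v-v^*(x_0)\|\le\delta$, with complexity at most $C_3\log(1/\varepsilon)$. 2. $\Phi_\delta$ is differentiable, and SFLCB with the parameters above, started from $x_0$, $y_0=z_0=\hat z$, $u_0=v_0=\hat v$, $\alpha_0=h(x_0,y_0)$, $\beta_0=h(x_0,z_0)$ and run for $T=\lceil C_2\varepsilon^{-3}\rceil$ iterations, has an iterate $x_t$, $0\le t<T$, with $\|\nabla\Phi_\delta(x_t)\|\le\varepsilon$; its complexity is at most $C_3\varepsilon^{-3}$. 3. The total complexity of the two phases is at most $C_3\varepsilon^{-3}$. -/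

import Mathlib

open scoped NNReal Matrix Matrix.Norms.L2Operator

/-- `ℝⁿ` with the Euclidean norm. -/
abbrev Vec (n : ℕ) : Type := EuclideanSpace ℝ (Fin n)

/-- The joint space `ℝᵐ × ℝⁿ` with the Euclidean norm `‖(x, y)‖² = ‖x‖² + ‖y‖²`. -/
abbrev Joint (m n : ℕ) : Type := WithLp 2 (Vec m × Vec n)

/-- The joint vector `(x, y)`. -/
def pair {m n : ℕ} (x : Vec m) (y : Vec n) : Joint m n := WithLp.toLp 2 (x, y)

/-- The projection onto the nonnegative orthant, computed coordinatewise. -/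
noncomputable def projNonneg {n : ℕ} (a : Vec n) : Vec n := WithLp.toLp 2 fun i => max (a i) 0

/-- The projection onto the nonpositive orthant, computed coordinatewise. -/
noncomputable def projNonpos {n : ℕ} (a : Vec n) : Vec n := WithLp.toLp 2 fun i => min (a i) 0

/-- `projNonneg a` is the point of the nonnegative orthant nearest to `a`. -/
theorem norm_sub_projNonneg_le {n : ℕ} (a w : Vec n) (hw : ∀ i, 0 ≤ w i) :
    (∀ i, 0 ≤ projNonneg a i) ∧ ‖a - projNonneg a‖ ≤ ‖a - w‖ := by
  refine ⟨fun i => le_max_right _ _, ?_⟩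
  rw [EuclideanSpace.norm_eq, EuclideanSpace.norm_eq]
  refine Real.sqrt_le_sqrt (Finset.sum_le_sum fun i _ => ?_)
  simp only [PiLp.sub_apply, Real.norm_eq_abs, sq_abs, projNonneg]
  have h := hw i
  rcases le_total (a i) 0 with h0 | h0
  · rw [max_eq_right h0]; nlinarith
  · rw [max_eq_left h0]; nlinarith [sq_nonneg (a i - w i)]

/-- `projNonpos a` is the point of the nonpositive orthant nearest to `a`. -/
theorem norm_sub_projNonpos_le {n : ℕ} (a w : Vec n) (hw : ∀ i, w i ≤ 0) :
    (∀ i, projNonpos a i ≤ 0) ∧ ‖a - projNonpos a‖ ≤ ‖a - w‖ := by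
  refine ⟨fun i => min_le_right _ _, ?_⟩
  rw [EuclideanSpace.norm_eq, EuclideanSpace.norm_eq]
  refine Real.sqrt_le_sqrt (Finset.sum_le_sum fun i _ => ?_)
  simp only [PiLp.sub_apply, Real.norm_eq_abs, sq_abs, projNonpos]
  have h := hw i
  rcases le_total (a i) 0 with h0 | h0
  · rw [min_eq_left h0]; nlinarith [sq_nonneg (a i - w i)]
  · rw [min_eq_right h0]; nlinarith

theorem hasGradientAt_comp_pair_left {m n : ℕ} {F : Joint m n → ℝ} (hF : Differentiable ℝ F)
    (x : Vec m) (y : Vec n) :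
    HasGradientAt (fun x => F (pair x y)) (gradient F (pair x y)).fst x := by
  have h1 := (hF (pair x y)).hasGradientAt.hasFDerivAt
  generalize gradient F (pair x y) = G at h1 ⊢
  have h2 : HasFDerivAt (fun x : Vec m => pair x y)
      ((WithLp.prodContinuousLinearEquiv 2 ℝ (Vec m) (Vec n)).symm.toContinuousLinearMap ∘L
        ContinuousLinearMap.inl ℝ (Vec m) (Vec n)) x :=
    HasFDerivAt.comp x (g := (WithLp.prodContinuousLinearEquiv 2 ℝ (Vec m) (Vec n)).symm)
      (ContinuousLinearEquiv.hasFDerivAt _) (hasFDerivAt_prodMk_left x y)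
  rw [hasGradientAt_iff_hasFDerivAt]
  refine (h1.comp x h2).congr_fderiv ?_
  ext w
  simp [WithLp.prod_inner_apply]

theorem hasGradientAt_comp_pair_right {m n : ℕ} {F : Joint m n → ℝ} (hF : Differentiable ℝ F)
    (x : Vec m) (y : Vec n) :
    HasGradientAt (fun y => F (pair x y)) (gradient F (pair x y)).snd y := by
  have h1 := (hF (pair x y)).hasGradientAt.hasFDerivAt
  generalize gradient F (pair x y) = G at h1 ⊢
  have h2 : HasFDerivAt (fun y : Vec n => pair x y)
      ((WithLp.prodContinuousLinearEquiv 2 ℝ (Vec m) (Vec n)).symm.toContinuousLinearMap ∘L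
        ContinuousLinearMap.inr ℝ (Vec m) (Vec n)) y :=
    HasFDerivAt.comp y (g := (WithLp.prodContinuousLinearEquiv 2 ℝ (Vec m) (Vec n)).symm)
      (ContinuousLinearEquiv.hasFDerivAt _) (hasFDerivAt_prodMk_right x y)
  rw [hasGradientAt_iff_hasFDerivAt]
  refine (h1.comp y h2).congr_fderiv ?_
  ext w
  simp [WithLp.prod_inner_apply]

theorem inner_transpose_toEuclideanLin {m n : ℕ} (M : Matrix (Fin m) (Fin n) ℝ) (u : Vec m)
    (w : Vec n) : inner ℝ (Mᵀ.toEuclideanLin u) w = inner ℝ u (M.toEuclideanLin w) := by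
  have h := Matrix.toEuclideanLin_conjTranspose_eq_adjoint M
  rw [Matrix.conjTranspose_eq_transpose_of_trivial] at h
  rw [h, LinearMap.adjoint_inner_left]

/-- Gradient of `x ↦ uᵀ r + (ρ / 2) ‖r‖²` for an affine residual `r = M x + k`. -/
theorem hasGradientAt_penalty {m n : ℕ} (M : Matrix (Fin m) (Fin n) ℝ) (r : Vec n → Vec m)
    (k : Vec m) (hr : ∀ x, r x = M.toEuclideanLin x + k) (u : Vec m) (ρ : ℝ) (x : Vec n) :
    HasGradientAt (fun x => inner ℝ u (r x) + ρ / 2 * ‖r x‖ ^ 2)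
      (Mᵀ.toEuclideanLin (u + ρ • r x)) x := by
  have h1 : HasFDerivAt r (LinearMap.toContinuousLinearMap M.toEuclideanLin) x := by
    have : r = fun x => (LinearMap.toContinuousLinearMap M.toEuclideanLin) x + k := by
      funext x; simp [hr]
    rw [this]
    exact (ContinuousLinearMap.hasFDerivAt _).add_const k
  rw [hasGradientAt_iff_hasFDerivAt]
  refine (((hasFDerivAt_const u x).inner ℝ h1).add
    (h1.norm_sq.const_mul (ρ / 2))).congr_fderiv ?_
  ext w
  simp only [InnerProductSpace.toDual_apply_apply, inner_transpose_toEuclideanLin,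
    inner_add_left, real_inner_smul_left]
  simp
  ring

/-- `y` minimises `φ` over `s`. -/
def IsMinimizer {n : ℕ} (s : Set (Vec n)) (φ : Vec n → ℝ) (y : Vec n) : Prop :=
  y ∈ s ∧ IsMinOn φ s y

/-- A chosen minimiser of `φ` over `s`; the minimiser as soon as there is exactly one. -/
noncomputable def argminOn {n : ℕ} (s : Set (Vec n)) (φ : Vec n → ℝ) : Vec n :=
  Classical.epsilon (IsMinimizer s φ)

/-- A result of a computation together with the number of gradient evaluations (first-order
oracle calls) that were spent on it. -/
structure Counted (α : Type) where
  /-- the result -/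
  val : α
  /-- the number of gradient evaluations -/
  calls : ℕ

instance : Monad Counted where
  pure a := ⟨a, 0⟩
  bind m k := ⟨(k m.val).val, m.calls + (k m.val).calls⟩

/-- Run `n` iterations of a counted step, adding up the gradient evaluations. -/
def Counted.iterate {σ : Type} (step : σ → Counted σ) : ℕ → σ → Counted σ
  | 0, s => pure s
  | n + 1, s => do
      let s' ← Counted.iterate step n s
      step s'

/-- The data of the bilevel problem: minimise `f (x, y*(x))` over `x ∈ ℝ^dx`, where `y*(x)`
minimises `g (x, ·)` over `{y ∈ ℝ^dy | B x + A y - b ≤ 0}`. -/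
structure LinBilevel {dx dy dh : ℕ} (B : Matrix (Fin dh) (Fin dx) ℝ)
    (A : Matrix (Fin dh) (Fin dy) ℝ) where
  /-- upper-level objective -/
  f : Joint dx dy → ℝ
  /-- lower-level objective -/
  g : Joint dx dy → ℝ
  /-- right-hand side of the constraints -/
  b : Vec dh

/-- The iterate of the projected gradient method for the lower-level max-min problem. -/
structure PGDState (dy dh : ℕ) where
  /-- primal variable -/
  z : Vec dy
  /-- multiplier -/
  v : Vec dh

/-- The iterate of SFLCB: `x`, `y' = (y, α)`, `z' = (z, β)`, `u`, `v`. -/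
structure SFLCBState (dx dy dh : ℕ) where
  /-- upper-level variable -/
  x : Vec dx
  /-- first copy of the lower-level variable -/
  y : Vec dy
  /-- slack variable of `y` -/
  α : Vec dh
  /-- second copy of the lower-level variable -/
  z : Vec dy
  /-- slack variable of `z` -/
  β : Vec dh
  /-- multiplier of the constraint on `(y, α)` -/
  u : Vec dh
  /-- multiplier of the constraint on `(z, β)` -/
  v : Vec dh

/-- The parameters of SFLCB other than the penalty parameter `δ` and the number of iterations. -/
structure SFLCBParams where
  /-- augmentation parameter for `(y, α)` -/
  ρ₁ : ℝ
  /-- augmentation parameter for `(z, β)` -/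
  ρ₂ : ℝ
  /-- step size for `x` -/
  ηx : ℝ
  /-- step size for `(y, α)` -/
  ηy : ℝ
  /-- step size for `(z, β)` -/
  ηz : ℝ
  /-- step size for `u` -/
  ηu : ℝ
  /-- step size for `v` -/
  ηv : ℝ

namespace LinBilevel

variable {dx dy dh : ℕ} {B : Matrix (Fin dh) (Fin dx) ℝ} {A : Matrix (Fin dh) (Fin dy) ℝ}

/-- The constraint function `h (x, y) = B x + A y - b`. -/
noncomputable def h (P : LinBilevel B A) (x : Vec dx) (y : Vec dy) : Vec dh :=
  B.toEuclideanLin x + A.toEuclideanLin y - P.b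

/-- The lower-level feasible set `𝒴(x) = {y | h (x, y) ≤ 0}`. -/
def feas (P : LinBilevel B A) (x : Vec dx) : Set (Vec dy) := {y | ∀ i, P.h x y i ≤ 0}

/-- The penalised lower-level objective `g_δ (x, y) = δ f (x, y) + g (x, y)`. -/
noncomputable def gδ (P : LinBilevel B A) (δ : ℝ) (x : Vec dx) (y : Vec dy) : ℝ :=
  δ * P.f (pair x y) + P.g (pair x y)

/-- `y*(x) = z*(x) = argmin_{y ∈ 𝒴(x)} g (x, y)`. -/
noncomputable def yStar (P : LinBilevel B A) (x : Vec dx) : Vec dy :=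
  argminOn (P.feas x) fun y => P.g (pair x y)

/-- `y*_δ(x) = argmin_{y ∈ 𝒴(x)} (δ f (x, y) + g (x, y))`. -/
noncomputable def yStarδ (P : LinBilevel B A) (δ : ℝ) (x : Vec dx) : Vec dy :=
  argminOn (P.feas x) (P.gδ δ x)

/-- The hyper-objective `Φ(x) = f (x, y*(x))`. -/
noncomputable def Phi (P : LinBilevel B A) (x : Vec dx) : ℝ := P.f (pair x (P.yStar x))

/-- `Φ_δ(x) = f (x, y*_δ(x)) + (g (x, y*_δ(x)) - g (x, y*(x))) / δ`, the value of
`min_{y ∈ 𝒴(x)} max_{z ∈ 𝒴(x)} f (x, y) + (g (x, y) - g (x, z)) / δ`. -/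
noncomputable def Phiδ (P : LinBilevel B A) (δ : ℝ) (x : Vec dx) : ℝ :=
  P.f (pair x (P.yStarδ δ x)) +
    1 / δ * (P.g (pair x (P.yStarδ δ x)) - P.g (pair x (P.yStar x)))

/-- The lower-level dual function `v ↦ min_{z ∈ ℝ^dy} g (x, z) + vᵀ (B x + A z - b)`. -/
noncomputable def dual (P : LinBilevel B A) (x : Vec dx) (v : Vec dh) : ℝ :=
  ⨅ z : Vec dy, (P.g (pair x z) + inner ℝ v (P.h x z))

/-- `v` is an optimal lower-level multiplier: it maximises the dual function over `v ≥ 0`. -/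
def IsMultiplier (P : LinBilevel B A) (x : Vec dx) (v : Vec dh) : Prop :=
  (∀ i, 0 ≤ v i) ∧ ∀ w : Vec dh, (∀ i, 0 ≤ w i) → P.dual x w ≤ P.dual x v

/-- The assumptions on the problem. -/
structure Assumptions (P : LinBilevel B A) (lf0 lf1 lg1 : ℝ≥0) (μg : ℝ) : Prop where
  contDiff_f : ContDiff ℝ 1 P.f
  contDiff_g : ContDiff ℝ 1 P.g
  bddBelow_Phi : BddBelow (Set.range P.Phi)
  lipschitz_f : LipschitzOnWith lf0 P.f {p | p.snd ∈ P.feas p.fst}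
  lipschitz_grad_f : LipschitzWith lf1 (gradient P.f)
  lipschitz_grad_g : LipschitzWith lg1 (gradient P.g)
  strongConvex_g : ∀ x, StrongConvexOn Set.univ μg fun y => P.g (pair x y)

/-- Evaluate the gradient of `f`, at the cost of one call. -/
noncomputable def queryF (P : LinBilevel B A) (p : Joint dx dy) : Counted (Joint dx dy) :=
  ⟨gradient P.f p, 1⟩

/-- Evaluate the gradient of `g`, at the cost of one call. -/
noncomputable def queryG (P : LinBilevel B A) (p : Joint dx dy) : Counted (Joint dx dy) :=
  ⟨gradient P.g p, 1⟩

/-- One iteration of projected gradient, with step sizes `τz` and `τv`, for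
`max_{v ≥ 0} min_z g (x₀, z) + vᵀ (B x₀ + A z - b)`: a gradient descent step in `z`, then a
projected gradient ascent step in `v`. -/
noncomputable def pgdStep (P : LinBilevel B A) (τz τv : ℝ) (x₀ : Vec dx) (s : PGDState dy dh) :
    Counted (PGDState dy dh) := do
  let G ← P.queryG (pair x₀ s.z)
  let z := s.z - τz • (G.snd + Aᵀ.toEuclideanLin s.v)
  let v := projNonneg (s.v + τv • P.h x₀ z)
  return { z := z, v := v }

/-- `n` iterations of the projected gradient method from the state `s`. -/
noncomputable def pgd (P : LinBilevel B A) (τz τv : ℝ) (x₀ : Vec dx) (n : ℕ)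
    (s : PGDState dy dh) : Counted (PGDState dy dh) :=
  Counted.iterate (P.pgdStep τz τv x₀) n s

/-- The augmented Lagrangian `K (x, y', z', u, v)` with `y' = (y, α)` and `z' = (z, β)`. -/
noncomputable def K (P : LinBilevel B A) (δ ρ₁ ρ₂ : ℝ) (x : Vec dx) (y : Vec dy) (α : Vec dh)
    (z : Vec dy) (β : Vec dh) (u v : Vec dh) : ℝ :=
  δ * P.f (pair x y) + P.g (pair x y) - P.g (pair x z)
    + inner ℝ u (P.h x y - α) - inner ℝ v (P.h x z - β)
    + ρ₁ / 2 * ‖P.h x y - α‖ ^ 2 - ρ₂ / 2 * ‖P.h x z - β‖ ^ 2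

/-- One iteration of SFLCB: an ascent step in `u` and a descent step in `v`, then projected
descent steps in `x` and `(y, α)` and a projected ascent step in `(z, β)` for `K`, the
gradients of `K` being expressed through those of `f` and `g` (see `sflcbStep_val`). -/
noncomputable def sflcbStep (P : LinBilevel B A) (δ : ℝ) (c : SFLCBParams)
    (s : SFLCBState dx dy dh) : Counted (SFLCBState dx dy dh) := do
  let Gf ← P.queryF (pair s.x s.y)
  let Gg ← P.queryG (pair s.x s.y)
  let Gz ← P.queryG (pair s.x s.z)
  let ry := P.h s.x s.y - s.α
  let rz := P.h s.x s.z - s.β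
  let u := s.u + c.ηu • ry
  let v := s.v + c.ηv • rz
  return {
    x := s.x - c.ηx • (δ • Gf.fst + Gg.fst - Gz.fst
      + Bᵀ.toEuclideanLin (u + c.ρ₁ • ry) - Bᵀ.toEuclideanLin (v + c.ρ₂ • rz))
    y := s.y - c.ηy • (δ • Gf.snd + Gg.snd + Aᵀ.toEuclideanLin (u + c.ρ₁ • ry))
    α := projNonpos (s.α - c.ηy • (-(u + c.ρ₁ • ry)))
    z := s.z + c.ηz • (-(Gz.snd + Aᵀ.toEuclideanLin (v + c.ρ₂ • rz)))
    β := projNonpos (s.β + c.ηz • (v + c.ρ₂ • rz))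
    u := u
    v := v }

/-- The iteration of SFLCB written with the gradients of `K`: the update directions of
`sflcbStep` are the partial gradients of `K` at `(x, y', z', u₊, v₊)`. -/
theorem sflcbStep_val (P : LinBilevel B A) (hf : Differentiable ℝ P.f)
    (hg : Differentiable ℝ P.g) (δ : ℝ) (c : SFLCBParams) (s : SFLCBState dx dy dh) :
    (P.sflcbStep δ c s).val =
      let u := s.u + c.ηu • (P.h s.x s.y - s.α)
      let v := s.v + c.ηv • (P.h s.x s.z - s.β)
      { x := s.x - c.ηx • gradient (fun x => P.K δ c.ρ₁ c.ρ₂ x s.y s.α s.z s.β u v) s.x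
        y := s.y - c.ηy • gradient (fun y => P.K δ c.ρ₁ c.ρ₂ s.x y s.α s.z s.β u v) s.y
        α := projNonpos
          (s.α - c.ηy • gradient (fun α => P.K δ c.ρ₁ c.ρ₂ s.x s.y α s.z s.β u v) s.α)
        z := s.z + c.ηz • gradient (fun z => P.K δ c.ρ₁ c.ρ₂ s.x s.y s.α z s.β u v) s.z
        β := projNonpos
          (s.β + c.ηz • gradient (fun β => P.K δ c.ρ₁ c.ρ₂ s.x s.y s.α s.z β u v) s.β)
        u := u
        v := v } := by
  extract_lets u v
  have gx : HasGradientAt (fun x => P.K δ c.ρ₁ c.ρ₂ x s.y s.α s.z s.β u v)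
      (δ • (gradient P.f (pair s.x s.y)).fst + (gradient P.g (pair s.x s.y)).fst
        - (gradient P.g (pair s.x s.z)).fst
        + Bᵀ.toEuclideanLin (u + c.ρ₁ • (P.h s.x s.y - s.α))
        - Bᵀ.toEuclideanLin (v + c.ρ₂ • (P.h s.x s.z - s.β))) s.x := by
    have h1 := hasGradientAt_comp_pair_left hf s.x s.y
    have h2 := hasGradientAt_comp_pair_left hg s.x s.y
    have h3 := hasGradientAt_comp_pair_left hg s.x s.z
    have h4 := hasGradientAt_penalty B (fun x => P.h x s.y - s.α)
      (A.toEuclideanLin s.y - P.b - s.α) (fun x => by simp only [h]; abel) u c.ρ₁ s.x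
    have h5 := hasGradientAt_penalty B (fun x => P.h x s.z - s.β)
      (A.toEuclideanLin s.z - P.b - s.β) (fun x => by simp only [h]; abel) v c.ρ₂ s.x
    rw [hasGradientAt_iff_hasFDerivAt] at *
    refine ((((((h1.const_mul δ).add h2).sub h3).add h4).sub h5).congr_of_eventuallyEq
      (.of_forall fun x => ?_)).congr_fderiv ?_
    · simp only [K, Pi.add_apply, Pi.sub_apply]; ring
    · simp
  have gy : HasGradientAt (fun y => P.K δ c.ρ₁ c.ρ₂ s.x y s.α s.z s.β u v)
      (δ • (gradient P.f (pair s.x s.y)).snd + (gradient P.g (pair s.x s.y)).snd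
        + Aᵀ.toEuclideanLin (u + c.ρ₁ • (P.h s.x s.y - s.α))) s.y := by
    have h1 := hasGradientAt_comp_pair_right hf s.x s.y
    have h2 := hasGradientAt_comp_pair_right hg s.x s.y
    have h4 := hasGradientAt_penalty A (fun y => P.h s.x y - s.α)
      (B.toEuclideanLin s.x - P.b - s.α) (fun x => by simp only [h]; abel) u c.ρ₁ s.y
    rw [hasGradientAt_iff_hasFDerivAt] at *
    refine ((((h1.const_mul δ).add h2).add h4).add_const
      (-P.g (pair s.x s.z) - inner ℝ v (P.h s.x s.z - s.β)
        - c.ρ₂ / 2 * ‖P.h s.x s.z - s.β‖ ^ 2) |>.congr_of_eventuallyEq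
      (.of_forall fun x => ?_)).congr_fderiv ?_
    · simp only [K, Pi.add_apply]; ring
    · simp
  have gz : HasGradientAt (fun z => P.K δ c.ρ₁ c.ρ₂ s.x s.y s.α z s.β u v)
      (-((gradient P.g (pair s.x s.z)).snd
        + Aᵀ.toEuclideanLin (v + c.ρ₂ • (P.h s.x s.z - s.β)))) s.z := by
    have h2 := hasGradientAt_comp_pair_right hg s.x s.z
    have h4 := hasGradientAt_penalty A (fun y => P.h s.x y - s.β)
      (B.toEuclideanLin s.x - P.b - s.β) (fun x => by simp only [h]; abel) v c.ρ₂ s.z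
    rw [hasGradientAt_iff_hasFDerivAt] at *
    refine ((h2.add h4).neg.add_const
      (δ * P.f (pair s.x s.y) + P.g (pair s.x s.y) + inner ℝ u (P.h s.x s.y - s.α)
        + c.ρ₁ / 2 * ‖P.h s.x s.y - s.α‖ ^ 2) |>.congr_of_eventuallyEq
      (.of_forall fun x => ?_)).congr_fderiv ?_
    · simp only [K, Pi.add_apply, Pi.neg_apply]; ring
    · simp
  have hneg : ∀ (k α : Vec dh), k - α = (-1 : Matrix (Fin dh) (Fin dh) ℝ).toEuclideanLin α + k := by
    intro k α
    ext i
    simp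
    ring
  have hT : ∀ w : Vec dh, (-1 : Matrix (Fin dh) (Fin dh) ℝ)ᵀ.toEuclideanLin w = -w := by
    intro w
    ext i
    simp
  have gα : HasGradientAt (fun α => P.K δ c.ρ₁ c.ρ₂ s.x s.y α s.z s.β u v)
      (-(u + c.ρ₁ • (P.h s.x s.y - s.α))) s.α := by
    have h4 := hasGradientAt_penalty (-1) (fun α => P.h s.x s.y - α) (P.h s.x s.y)
      (fun α => hneg _ _) u c.ρ₁ s.α
    rw [hT, hasGradientAt_iff_hasFDerivAt] at h4
    rw [hasGradientAt_iff_hasFDerivAt]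
    refine h4.add_const (δ * P.f (pair s.x s.y) + P.g (pair s.x s.y) - P.g (pair s.x s.z)
      - inner ℝ v (P.h s.x s.z - s.β) - c.ρ₂ / 2 * ‖P.h s.x s.z - s.β‖ ^ 2)
      |>.congr_of_eventuallyEq (.of_forall fun x => ?_)
    simp only [K]; ring
  have gβ : HasGradientAt (fun β => P.K δ c.ρ₁ c.ρ₂ s.x s.y s.α s.z β u v)
      (v + c.ρ₂ • (P.h s.x s.z - s.β)) s.β := by
    have h4 := hasGradientAt_penalty (-1) (fun β => P.h s.x s.z - β) (P.h s.x s.z)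
      (fun α => hneg _ _) v c.ρ₂ s.β
    rw [hT, hasGradientAt_iff_hasFDerivAt] at h4
    rw [hasGradientAt_iff_hasFDerivAt]
    refine (h4.neg.add_const (δ * P.f (pair s.x s.y) + P.g (pair s.x s.y) - P.g (pair s.x s.z)
      + inner ℝ u (P.h s.x s.y - s.α) + c.ρ₁ / 2 * ‖P.h s.x s.y - s.α‖ ^ 2)
      |>.congr_of_eventuallyEq (.of_forall fun x => ?_)).congr_fderiv ?_
    · simp only [K, Pi.neg_apply]; ring
    · simp
  rw [gx.gradient, gy.gradient, gz.gradient, gα.gradient, gβ.gradient]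
  rfl

/-- `T` iterations of SFLCB from the state `s`. -/
noncomputable def sflcb (P : LinBilevel B A) (δ : ℝ) (c : SFLCBParams) (T : ℕ)
    (s : SFLCBState dx dy dh) : Counted (SFLCBState dx dy dh) :=
  Counted.iterate (P.sflcbStep δ c) T s

/-- The initial state of SFLCB built from `x₀`, `ẑ` and `v̂`: `y₀ = z₀ = ẑ`, `u₀ = v₀ = v̂`,
`α₀ = h (x₀, y₀)`, `β₀ = h (x₀, z₀)`. -/
noncomputable def warmStart (P : LinBilevel B A) (x₀ : Vec dx) (s : PGDState dy dh) :
    SFLCBState dx dy dh where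
  x := x₀
  y := s.z
  α := P.h x₀ s.z
  z := s.z
  β := P.h x₀ s.z
  u := s.v
  v := s.v

end LinBilevel

/-! For fixed `x` the function `K` splits into two independent blocks: `(y, α, u)` is the augmented
Lagrangian of `δ f + g` over `𝒴(x)`, and `(z, β, v)`, up to sign, that of `g`. They interact only
through `x`. Since `2 l_{f,1} δ ≤ μ_g`, both objectives satisfy `Regular` with the same constants,
independent of `δ`, and so all step sizes and rates can be chosen independent of `δ`.

Each block, and PGD as well, is an instance of one abstract scheme (`PrimalDual`). The primal step
is a contraction. Because `A` has full row rank, `Aᵀ` is bounded below, so a multiplier is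
controlled by the gradient it balances and the dual problem is strongly concave. Hence a small dual
step makes a Lyapunov function `W`, comparable to the squared distance to the KKT pair, contract by
a fixed factor, up to `C ‖x - x'‖²` when the parameter moves (`exists_primalDual_rate`). With `x`
fixed this is the linear rate of PGD (`exists_pgd_rate`); for SFLCB it says that each block tracks
its solution (`exists_aug_rate`).

By definition `δ Φ_δ` is the difference of the optimal values of the two blocks. The envelope
theorem in quantitative form (`exists_envelope_bound`) gives its gradient, `∇ₓ` of the objective
plus `Bᵀ` times the multiplier for each block, with a quadratic remainder. The direction of the
`x`-step is this gradient evaluated at the current iterates, with squared error `O(W)`. For small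
`ηx` the potential `δ Φ_δ(x) + W` therefore drops by `(ηx / 2) (δ ‖∇Φ_δ‖)²` per iteration
(`exists_sflcb_decrease`).

The solutions for `δ f + g` and `g` are `O(δ)` apart, so a `δ`-accurate warm start makes the initial
`W` of order `δ²`. Also `Φ - O(δ) ≤ Φ_δ ≤ Φ`, so the total drop of the potential is `O(δ)`. If all
gradients exceeded `ε`, then `T δ² ε² = O(δ)`, that is `T = O(1 / (δ ε²)) = O(ε⁻³)`. -/

/-! ### Contraction of an abstract primal-dual scheme -/

/-- A gradient step of length `m / L ^ 2` along an `m`-strongly monotone `L`-Lipschitz operator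
contracts distances. -/
theorem norm_sub_smul_sub_le {H : Type*} [NormedAddCommGroup H] [InnerProductSpace ℝ H] {m L : ℝ}
    (hm : 0 < m) (hmL : m ≤ L) {p p' w w' : H}
    (hmono : m * ‖p - p'‖ ^ 2 ≤ inner ℝ (w - w') (p - p')) (hlip : ‖w - w'‖ ≤ L * ‖p - p'‖) :
    ‖(p - (m / L ^ 2) • w) - (p' - (m / L ^ 2) • w')‖ ≤ (1 - m ^ 2 / (2 * L ^ 2)) * ‖p - p'‖ := by
  have hL : 0 < L := hm.trans_le hmL
  have hq : 0 ≤ 1 - m ^ 2 / (2 * L ^ 2) := by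
    rw [sub_nonneg, div_le_one (by positivity)]; nlinarith
  refine le_of_sq_le_sq ?_ (by positivity)
  have e : (p - (m / L ^ 2) • w) - (p' - (m / L ^ 2) • w')
      = (p - p') - (m / L ^ 2) • (w - w') := by rw [smul_sub]; abel
  rw [e, norm_sub_sq_real, inner_smul_right, real_inner_comm, norm_smul, Real.norm_eq_abs,
    abs_of_pos (by positivity), mul_pow, mul_pow]
  have h1 : ‖w - w'‖ ^ 2 ≤ L ^ 2 * ‖p - p'‖ ^ 2 := by
    rw [← mul_pow]; exact pow_le_pow_left₀ (norm_nonneg _) hlip 2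
  have h2 : (m / L ^ 2) ^ 2 * ‖w - w'‖ ^ 2 ≤ (m / L ^ 2) ^ 2 * (L ^ 2 * ‖p - p'‖ ^ 2) := by gcongr
  have h3 : m / L ^ 2 * (m * ‖p - p'‖ ^ 2) ≤ m / L ^ 2 * inner ℝ (w - w') (p - p') := by gcongr
  have h4 : (m / L ^ 2) ^ 2 * (L ^ 2 * ‖p - p'‖ ^ 2) = m / L ^ 2 * (m * ‖p - p'‖ ^ 2) := by
    field_simp
  have h5 : (1 - m ^ 2 / (2 * L ^ 2)) ^ 2 * ‖p - p'‖ ^ 2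
      = ‖p - p'‖ ^ 2 - m / L ^ 2 * (m * ‖p - p'‖ ^ 2)
        + (m ^ 2 / (2 * L ^ 2)) ^ 2 * ‖p - p'‖ ^ 2 := by
    field_simp; ring
  have h6 : 0 ≤ (m ^ 2 / (2 * L ^ 2)) ^ 2 * ‖p - p'‖ ^ 2 := by positivity
  linarith

/-- A primal-dual scheme: `Φ x · u` is a contractive primal step, `R x` the residual that drives
the dual variable, and `D` the projection onto the dual domain. -/
structure PrimalDual {X Y U : Type*} [NormedAddCommGroup X] [NormedAddCommGroup Y]
    [NormedAddCommGroup U] [InnerProductSpace ℝ U] (q L κ : ℝ) (Φ : X → Y → U → Y)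
    (R : X → Y → U) (D : U → U) : Prop where
  primal : ∀ x x' y y' u u',
    ‖Φ x y u - Φ x' y' u'‖ ≤ q * ‖y - y'‖ + L * (‖u - u'‖ + ‖x - x'‖)
  residual : ∀ x x' y y', ‖R x y - R x' y'‖ ≤ L * (‖y - y'‖ + ‖x - x'‖)
  dual : ∀ x y y' u u', Φ x y u = y → Φ x y' u' = y' →
    inner ℝ (u - u') (R x y - R x y') ≤ -(κ * ‖u - u'‖ ^ 2)
  firm : ∀ a b, ‖D a - D b‖ ^ 2 + ‖(a - D a) - (b - D b)‖ ^ 2 ≤ ‖a - b‖ ^ 2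

theorem exists_fixedPoint_of_lipschitz {Y : Type*} [NormedAddCommGroup Y] [CompleteSpace Y]
    {q : ℝ} (hq0 : 0 ≤ q) (hq1 : q < 1) (f : Y → Y) (hf : ∀ y y', ‖f y - f y'‖ ≤ q * ‖y - y'‖) :
    ∃ y, f y = y := by
  have hc : ContractingWith ⟨q, hq0⟩ f :=
    ⟨by exact_mod_cast hq1, LipschitzWith.of_dist_le_mul fun y y' => by
      rw [dist_eq_norm, dist_eq_norm]; exact hf y y'⟩
  exact ⟨hc.fixedPoint, hc.fixedPoint_isFixedPt⟩

theorem add_sq_le_weighted {c : ℝ} (hc : 0 < c) (a b : ℝ) :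
    (a + b) ^ 2 ≤ (1 + c / 2) * a ^ 2 + (1 + 2 / c) * b ^ 2 := by
  have h : 0 ≤ (c * a - 2 * b) ^ 2 / (2 * c) := by positivity
  have e : (1 + c / 2) * a ^ 2 + (1 + 2 / c) * b ^ 2 - (a + b) ^ 2
      = (c * a - 2 * b) ^ 2 / (2 * c) := by field_simp; ring
  linarith

/-- The scalar estimate behind the contraction of the primal-dual scheme. -/
theorem primalDual_scalar {q L κ M N θ τ a b a₁ b₁ s d e : ℝ} (hq0 : 0 ≤ q) (hq1 : q < 1)
    (hκ : 0 < κ) (hM : 0 < M) (hθ : θ = (1 - q) / (2 * M ^ 2)) (hτ : 0 < τ) (hτ1 : τ ≤ 1)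
    (hτN : 8 * N ^ 2 * τ ≤ κ) (hτθ : 2 * (L ^ 2 / κ + 4 * L ^ 2) * τ ≤ θ * (1 - q))
    (hd : 0 ≤ d) (he : 0 ≤ e) (ha₁ : 0 ≤ a₁)
    (heab : e ≤ L * a + N * b) (hds : d ≤ s + τ * e) (haq : a₁ ≤ q * a + M * d)
    (hb : b₁ ^ 2 ≤ b ^ 2 - 2 * τ * κ * b ^ 2 + 2 * τ * L * a * b + τ ^ 2 * e ^ 2 - s ^ 2) :
    θ * a₁ ^ 2 + b₁ ^ 2 ≤ θ * (1 - (1 - q) / 2) * a ^ 2 + (1 - τ * κ / 2) * b ^ 2 := by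
  have hq : 0 < 1 - q := by linarith
  have hθ0 : 0 < θ := by rw [hθ]; positivity
  -- Convexity of the square with weights `q` and `1 - q`.
  have h1 : a₁ ^ 2 ≤ q * a ^ 2 + M ^ 2 * d ^ 2 / (1 - q) := by
    have h : a₁ ^ 2 ≤ (q * a + M * d) ^ 2 := pow_le_pow_left₀ ha₁ haq 2
    have h' : q * a ^ 2 + M ^ 2 * d ^ 2 / (1 - q) - (q * a + M * d) ^ 2
        = q / (1 - q) * ((1 - q) * a - M * d) ^ 2 := by field_simp; ring
    have : 0 ≤ q / (1 - q) * ((1 - q) * a - M * d) ^ 2 := by positivity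
    linarith
  have h2 : d ^ 2 ≤ 2 * s ^ 2 + 2 * (τ * e) ^ 2 := by
    have h : d ^ 2 ≤ (s + τ * e) ^ 2 := pow_le_pow_left₀ hd hds 2
    nlinarith [sq_nonneg (s - τ * e)]
  -- The choice of `θ` turns the effect of the dual move `d` into `d² / 2`, which the term `-s²`
  -- from firm nonexpansiveness absorbs up to `(τ e)²`.
  have h3 : θ * a₁ ^ 2 ≤ θ * q * a ^ 2 + s ^ 2 + (τ * e) ^ 2 := by
    have h : θ * a₁ ^ 2 ≤ θ * (q * a ^ 2 + M ^ 2 * d ^ 2 / (1 - q)) := by gcongr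
    have h' : θ * (q * a ^ 2 + M ^ 2 * d ^ 2 / (1 - q)) = θ * q * a ^ 2 + d ^ 2 / 2 := by
      rw [hθ]; field_simp
    linarith
  have h4 : e ^ 2 ≤ 2 * L ^ 2 * a ^ 2 + 2 * N ^ 2 * b ^ 2 := by
    have h : e ^ 2 ≤ (L * a + N * b) ^ 2 := pow_le_pow_left₀ he heab 2
    nlinarith [sq_nonneg (L * a - N * b)]
  have h5 : 2 * L * a * b ≤ κ * b ^ 2 + L ^ 2 / κ * a ^ 2 := by
    have e : κ * b ^ 2 + L ^ 2 / κ * a ^ 2 - 2 * L * a * b = (κ * b - L * a) ^ 2 / κ := by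
      field_simp; ring
    have : 0 ≤ (κ * b - L * a) ^ 2 / κ := by positivity
    linarith
  have h6 : τ * (2 * L * a * b) ≤ τ * (κ * b ^ 2 + L ^ 2 / κ * a ^ 2) := by gcongr
  have h7 : 2 * τ ^ 2 * e ^ 2 ≤ 2 * τ ^ 2 * (2 * L ^ 2 * a ^ 2 + 2 * N ^ 2 * b ^ 2) := by gcongr
  have h8 : τ ^ 2 * (4 * L ^ 2 * a ^ 2) ≤ τ * (4 * L ^ 2 * a ^ 2) := by
    gcongr; nlinarith
  have h9 : 8 * N ^ 2 * τ * (τ * b ^ 2) ≤ κ * (τ * b ^ 2) := by gcongr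
  have h10 : 2 * (L ^ 2 / κ + 4 * L ^ 2) * τ * a ^ 2 ≤ θ * (1 - q) * a ^ 2 := by gcongr
  nlinarith

-- The Lyapunov function is `W x y u = θ ‖y - Y x u‖² + ‖u - us x‖²`, where `Y x u` is the fixed
-- point of the primal step for frozen `u`. Measuring the primal error against `Y x u` instead of
-- the final solution lets the strong monotonicity of the reduced dual map `u ↦ -R x (Y x u)` act
-- directly. The dual update comes first and the primal step uses the new `u'`.
set_option maxHeartbeats 1000000 in
theorem exists_primalDual_rate {X Y U : Type*} [NormedAddCommGroup X] [NormedAddCommGroup Y]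
    [CompleteSpace Y] [NormedAddCommGroup U] [InnerProductSpace ℝ U] [CompleteSpace U]
    {q L κ : ℝ} (hq0 : 0 ≤ q) (hq1 : q < 1) (hL : 0 < L) (hκ : 0 < κ) :
    ∃ τ c C : ℝ, 0 < τ ∧ 0 < c ∧ c < 1 ∧ 0 < C ∧
      ∀ (Φ : X → Y → U → Y) (R : X → Y → U) (D : U → U), PrimalDual q L κ Φ R D →
      ∃ (ys : X → Y) (us : X → U) (W : X → Y → U → ℝ),
        (∀ x, Φ x (ys x) (us x) = ys x) ∧ (∀ x, D (us x + τ • R x (ys x)) = us x) ∧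
        (∀ x x', ‖ys x - ys x'‖ ≤ C * ‖x - x'‖) ∧ (∀ x x', ‖us x - us x'‖ ≤ C * ‖x - x'‖) ∧
        (∀ x y u, ‖y - ys x‖ ^ 2 + ‖u - us x‖ ^ 2 ≤ C * W x y u) ∧
        (∀ x y u, W x y u ≤ C * (‖y - ys x‖ ^ 2 + ‖u - us x‖ ^ 2)) ∧
        (∀ x x' y u, let u' := D (u + τ • R x y)
          W x' (Φ x y u') u' ≤ (1 - c) * W x y u + C * ‖x - x'‖ ^ 2) := by
  have hq : 0 < 1 - q := by linarith
  -- `M`, `N` and, below, `P` are the Lipschitz constants of `Y x u`, of `R x (Y x u)` and of the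
  -- dual fixed point `us x`.
  obtain ⟨M, hM⟩ : ∃ M, M = L / (1 - q) := ⟨_, rfl⟩
  have hM0 : 0 < M := by rw [hM]; positivity
  obtain ⟨N, hN⟩ : ∃ N, N = L * (M + 1) := ⟨_, rfl⟩
  have hN0 : 0 < N := by rw [hN]; positivity
  obtain ⟨θ, hθ⟩ : ∃ θ, θ = (1 - q) / (2 * M ^ 2) := ⟨_, rfl⟩
  have hθ0 : 0 < θ := by rw [hθ]; positivity
  obtain ⟨τ, hτ0, hτ1, hτN, hτκ, hτθ⟩ : ∃ τ : ℝ, 0 < τ ∧ τ ≤ 1 ∧ 8 * N ^ 2 * τ ≤ κ ∧ τ * κ ≤ 1 ∧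
      2 * (L ^ 2 / κ + 4 * L ^ 2) * τ ≤ θ * (1 - q) := by
    refine ⟨min (min 1 (κ / (8 * N ^ 2)))
      (min (1 / κ) (θ * (1 - q) / (2 * (L ^ 2 / κ + 4 * L ^ 2)))), ?_, ?_, ?_, ?_, ?_⟩
    · positivity
    · exact (min_le_left _ _).trans (min_le_left _ _)
    · rw [mul_comm, ← le_div_iff₀ (by positivity)]
      exact (min_le_left _ _).trans (min_le_right _ _)
    · rw [← le_div_iff₀ (by positivity)]
      exact (min_le_right _ _).trans (min_le_left _ _)
    · rw [mul_comm, ← le_div_iff₀ (by positivity)]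
      exact (min_le_right _ _).trans (min_le_right _ _)
  obtain ⟨c, hc⟩ : ∃ c, c = min (τ * κ / 2) ((1 - q) / 2) := ⟨_, rfl⟩
  have hc0 : 0 < c := by rw [hc]; positivity
  have hc1 : c ≤ τ * κ / 2 := hc ▸ min_le_left _ _
  have hc2 : c ≤ (1 - q) / 2 := hc ▸ min_le_right _ _
  obtain ⟨P, hP⟩ : ∃ P, P = 2 * N / κ := ⟨_, rfl⟩
  have hP0 : 0 < P := by rw [hP]; positivity
  obtain ⟨C, hC0, hC1, hC2, hC3, hC4, hC5, hC6, hC7⟩ : ∃ C : ℝ, 0 < C ∧ M * P + M ≤ C ∧ P ≤ C ∧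
      2 / θ ≤ C ∧ 2 * M ^ 2 + 1 ≤ C ∧ 2 * θ ≤ C ∧ 2 * θ * M ^ 2 + 1 ≤ C ∧
      (1 + 2 / c) * (θ * M ^ 2 + P ^ 2) ≤ C := by
    refine ⟨(M * P + M) + P + 2 / θ + (2 * M ^ 2 + 1) + 2 * θ + (2 * θ * M ^ 2 + 1)
      + (1 + 2 / c) * (θ * M ^ 2 + P ^ 2), ?_⟩
    have h1 : 0 < M * P + M := by positivity
    have h2 : 0 < 2 / θ := by positivity
    have h3 : 0 < 2 * M ^ 2 + 1 := by positivity
    have h4 : 0 < 2 * θ * M ^ 2 + 1 := by positivity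
    have h5 : 0 < (1 + 2 / c) * (θ * M ^ 2 + P ^ 2) := by positivity
    refine ⟨?_, ?_, ?_, ?_, ?_, ?_, ?_, ?_⟩ <;> linarith
  -- For fixed `x` the rate is `c`; half of it pays for the cross terms caused by moving `x`, as `(1
  -- + c / 2) (1 - c) ≤ 1 - c / 2`.
  refine ⟨τ, c / 2, C, hτ0, by positivity, by linarith, hC0, fun Φ R D H => ?_⟩
  have hY : ∀ x u, ∃ y, Φ x y u = y := fun x u =>
    exists_fixedPoint_of_lipschitz hq0 hq1 (fun y => Φ x y u) fun y y' => by
      simpa using H.primal x x y y' u u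
  choose Y hY using hY
  have hYL : ∀ x x' u u', ‖Y x u - Y x' u'‖ ≤ M * (‖u - u'‖ + ‖x - x'‖) := by
    intro x x' u u'
    have h := H.primal x x' (Y x u) (Y x' u') u u'
    rw [hY, hY] at h
    rw [hM, div_mul_eq_mul_div, le_div_iff₀ hq]
    linarith
  have hRL : ∀ x x' u u', ‖R x (Y x u) - R x' (Y x' u')‖ ≤ N * (‖u - u'‖ + ‖x - x'‖) := by
    intro x x' u u'
    have h := H.residual x x' (Y x u) (Y x' u')
    have h' : L * (‖Y x u - Y x' u'‖ + ‖x - x'‖)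
        ≤ L * (M * (‖u - u'‖ + ‖x - x'‖) + (‖u - u'‖ + ‖x - x'‖)) := by
      gcongr
      · exact hYL x x' u u'
      · linarith [norm_nonneg (u - u')]
    rw [hN]
    linarith
  have hD : ∀ a b, ‖D a - D b‖ ≤ ‖a - b‖ := fun a b =>
    le_of_sq_le_sq (by linarith [H.firm a b, sq_nonneg ‖(a - D a) - (b - D b)‖]) (norm_nonneg _)
  have hτκ' : 0 ≤ 1 - τ * κ / 2 := by linarith
  -- The reduced dual iteration is a nonexpansive map after a step along a strongly monotone
  -- Lipschitz operator, hence a contraction; its fixed point is `us x`.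
  have hΨ : ∀ x u u', ‖D (u + τ • R x (Y x u)) - D (u' + τ • R x (Y x u'))‖
      ≤ (1 - τ * κ / 2) * ‖u - u'‖ := by
    intro x u u'
    refine (hD _ _).trans (le_of_sq_le_sq ?_ (by positivity))
    have e : u + τ • R x (Y x u) - (u' + τ • R x (Y x u'))
        = (u - u') + τ • (R x (Y x u) - R x (Y x u')) := by rw [smul_sub]; abel
    rw [e, norm_add_sq_real, inner_smul_right, norm_smul, Real.norm_eq_abs, abs_of_pos hτ0]
    have h1 := H.dual x _ _ u u' (hY x u) (hY x u')
    have h2 : ‖R x (Y x u) - R x (Y x u')‖ ^ 2 ≤ (N * ‖u - u'‖) ^ 2 :=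
      pow_le_pow_left₀ (norm_nonneg _) (by simpa using hRL x x u u') 2
    have h3 : τ * inner ℝ (u - u') (R x (Y x u) - R x (Y x u'))
        ≤ τ * -(κ * ‖u - u'‖ ^ 2) := by gcongr
    have h4 : τ ^ 2 * ‖R x (Y x u) - R x (Y x u')‖ ^ 2 ≤ τ ^ 2 * (N * ‖u - u'‖) ^ 2 := by gcongr
    have h5 : 8 * N ^ 2 * τ * (τ * ‖u - u'‖ ^ 2) ≤ κ * (τ * ‖u - u'‖ ^ 2) := by gcongr
    have h6 : 0 ≤ (τ * κ / 2) ^ 2 * ‖u - u'‖ ^ 2 := by positivity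
    have h7 : 0 ≤ κ * (τ * ‖u - u'‖ ^ 2) := by positivity
    nlinarith
  have hU : ∀ x, ∃ u, D (u + τ • R x (Y x u)) = u := fun x =>
    exists_fixedPoint_of_lipschitz hτκ' (by nlinarith [mul_pos hτ0 hκ])
      (fun u => D (u + τ • R x (Y x u))) (hΨ x)
  choose us hus using hU
  have husL : ∀ x x', ‖us x - us x'‖ ≤ P * ‖x - x'‖ := by
    intro x x'
    have h1 := hΨ x (us x) (us x')
    have h2 : ‖D (us x' + τ • R x (Y x (us x'))) - D (us x' + τ • R x' (Y x' (us x')))‖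
        ≤ τ * (N * ‖x - x'‖) := by
      refine (hD _ _).trans ?_
      rw [add_sub_add_left_eq_sub, ← smul_sub, norm_smul, Real.norm_eq_abs, abs_of_pos hτ0]
      gcongr
      simpa using hRL x x' (us x') (us x')
    rw [hus] at h1 h2
    have h3 := norm_sub_le_norm_sub_add_norm_sub (us x) (D (us x' + τ • R x (Y x (us x')))) (us x')
    have h4 : τ * (κ / 2 * ‖us x - us x'‖) ≤ τ * (N * ‖x - x'‖) := by linarith
    have h5 := le_of_mul_le_mul_left h4 hτ0
    rw [hP, div_mul_eq_mul_div, le_div_iff₀ hκ]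
    linarith
  refine ⟨fun x => Y x (us x), us, fun x y u => θ * ‖y - Y x u‖ ^ 2 + ‖u - us x‖ ^ 2,
    fun x => hY _ _, hus, fun x x' => ?_, fun x x' => ?_, fun x y u => ?_, fun x y u => ?_,
    fun x x' y u => ?_⟩
  · calc ‖Y x (us x) - Y x' (us x')‖ ≤ M * (‖us x - us x'‖ + ‖x - x'‖) := hYL _ _ _ _
      _ ≤ M * (P * ‖x - x'‖ + ‖x - x'‖) := by gcongr; exact husL x x'
      _ = (M * P + M) * ‖x - x'‖ := by ring
      _ ≤ C * ‖x - x'‖ := by gcongr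
  · exact (husL x x').trans (by gcongr)
  · have h1 : ‖y - Y x (us x)‖ ≤ ‖y - Y x u‖ + M * ‖u - us x‖ := by
      refine (norm_sub_le_norm_sub_add_norm_sub _ (Y x u) _).trans ?_
      gcongr
      simpa using hYL x x u (us x)
    have h2 : ‖y - Y x (us x)‖ ^ 2 ≤ 2 * ‖y - Y x u‖ ^ 2 + 2 * (M * ‖u - us x‖) ^ 2 := by
      have := pow_le_pow_left₀ (norm_nonneg _) h1 2
      nlinarith [sq_nonneg (‖y - Y x u‖ - M * ‖u - us x‖)]
    have h3 : 2 / θ * (θ * ‖y - Y x u‖ ^ 2) ≤ C * (θ * ‖y - Y x u‖ ^ 2) := by gcongr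
    have h4 : (2 * M ^ 2 + 1) * ‖u - us x‖ ^ 2 ≤ C * ‖u - us x‖ ^ 2 := by gcongr
    have h5 : 2 / θ * (θ * ‖y - Y x u‖ ^ 2) = 2 * ‖y - Y x u‖ ^ 2 := by field_simp
    linarith
  · have h1 : ‖y - Y x u‖ ≤ ‖y - Y x (us x)‖ + M * ‖u - us x‖ := by
      refine (norm_sub_le_norm_sub_add_norm_sub _ (Y x (us x)) _).trans ?_
      gcongr
      rw [norm_sub_rev u]
      simpa using hYL x x (us x) u
    have h2 : ‖y - Y x u‖ ^ 2 ≤ 2 * ‖y - Y x (us x)‖ ^ 2 + 2 * (M * ‖u - us x‖) ^ 2 := by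
      have := pow_le_pow_left₀ (norm_nonneg _) h1 2
      nlinarith [sq_nonneg (‖y - Y x (us x)‖ - M * ‖u - us x‖)]
    have h3 : θ * ‖y - Y x u‖ ^ 2
        ≤ θ * (2 * ‖y - Y x (us x)‖ ^ 2 + 2 * (M * ‖u - us x‖) ^ 2) := by gcongr
    have h4 : 2 * θ * ‖y - Y x (us x)‖ ^ 2 ≤ C * ‖y - Y x (us x)‖ ^ 2 := by gcongr
    have h5 : (2 * θ * M ^ 2 + 1) * ‖u - us x‖ ^ 2 ≤ C * ‖u - us x‖ ^ 2 := by gcongr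
    linarith
  · intro u'
    set b := ‖u - us x‖ with hb
    set a := ‖y - Y x u‖ with ha
    set r := R x y - R x (Y x (us x)) with hr
    have her : ‖r‖ ≤ L * a + N * b := by
      have h1 : ‖R x y - R x (Y x u)‖ ≤ L * a := by simpa using H.residual x x y (Y x u)
      have h2 : ‖R x (Y x u) - R x (Y x (us x))‖ ≤ N * b := by simpa using hRL x x u (us x)
      exact (norm_sub_le_norm_sub_add_norm_sub _ (R x (Y x u)) _).trans (add_le_add h1 h2)
    have hfirm := H.firm (u + τ • R x y) (us x + τ • R x (Y x (us x)))
    rw [hus] at hfirm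
    change ‖u' - us x‖ ^ 2 + ‖u + τ • R x y - u' - _‖ ^ 2 ≤ _ at hfirm
    have e1 : u + τ • R x y - u' - (us x + τ • R x (Y x (us x)) - us x)
        = (u - u') + τ • r := by rw [hr, smul_sub]; abel
    have e2 : u + τ • R x y - (us x + τ • R x (Y x (us x))) = (u - us x) + τ • r := by
      rw [hr, smul_sub]; abel
    rw [e1, e2, norm_add_sq_real (u - us x), inner_smul_right, norm_smul τ, Real.norm_eq_abs,
      abs_of_pos hτ0] at hfirm
    -- Splitting `r` at the exact response `Y x u` leaves a strongly monotone part and an error of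
    -- size `L a`.
    have hin : inner ℝ (u - us x) r ≤ -(κ * b ^ 2) + b * (L * a) := by
      have e : r = (R x (Y x u) - R x (Y x (us x))) + (R x y - R x (Y x u)) := by rw [hr]; abel
      rw [e, inner_add_right]
      refine add_le_add (H.dual x _ _ u (us x) (hY _ _) (hY _ _))
        ((real_inner_le_norm _ _).trans ?_)
      gcongr
      simpa using H.residual x x y (Y x u)
    have hds : ‖u' - u‖ ≤ ‖(u - u') + τ • r‖ + τ * ‖r‖ := by
      have h := norm_sub_le ((u - u') + τ • r) (τ • r)
      rw [add_sub_cancel_right, norm_smul, Real.norm_eq_abs, abs_of_pos hτ0, norm_sub_rev] at h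
      exact h
    have haq : ‖Φ x y u' - Y x u'‖ ≤ q * a + M * ‖u' - u‖ := by
      have h1 := H.primal x x y (Y x u') u' u'
      rw [hY] at h1
      simp only [sub_self, norm_zero, add_zero, mul_zero] at h1
      have h2 : ‖y - Y x u'‖ ≤ a + M * ‖u' - u‖ := by
        refine (norm_sub_le_norm_sub_add_norm_sub _ (Y x u) _).trans ?_
        rw [norm_sub_rev u']
        gcongr
        simpa using hYL x x u u'
      have h3 : q * ‖y - Y x u'‖ ≤ q * (a + M * ‖u' - u‖) := by gcongr
      have h4 : q * (M * ‖u' - u‖) ≤ 1 * (M * ‖u' - u‖) := by gcongr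
      linarith
    have hmain := primalDual_scalar (b₁ := ‖u' - us x‖) hq0 hq1 hκ hM0 hθ hτ0 hτ1 hτN hτθ
      (norm_nonneg _) (norm_nonneg r) (norm_nonneg (Φ x y u' - Y x u')) her hds haq (by
        have := mul_le_mul_of_nonneg_left hin hτ0.le
        nlinarith)
    have hmove1 : ‖Φ x y u' - Y x' u'‖ ≤ ‖Φ x y u' - Y x u'‖ + M * ‖x - x'‖ := by
      refine (norm_sub_le_norm_sub_add_norm_sub _ (Y x u') _).trans ?_
      gcongr
      simpa using hYL x x' u' u'
    have hmove2 : ‖u' - us x'‖ ≤ ‖u' - us x‖ + P * ‖x - x'‖ := by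
      refine (norm_sub_le_norm_sub_add_norm_sub _ (us x) _).trans ?_
      gcongr
      exact husL x x'
    have h1 := (pow_le_pow_left₀ (norm_nonneg _) hmove1 2).trans (add_sq_le_weighted hc0 _ _)
    have h2 := (pow_le_pow_left₀ (norm_nonneg _) hmove2 2).trans (add_sq_le_weighted hc0 _ _)
    have h3 := mul_le_mul_of_nonneg_left h1 hθ0.le
    have h4 : (1 + 2 / c) * (θ * M ^ 2 + P ^ 2) * ‖x - x'‖ ^ 2 ≤ C * ‖x - x'‖ ^ 2 := by gcongr
    have h5 : θ * (1 - (1 - q) / 2) * a ^ 2 ≤ θ * (1 - c) * a ^ 2 := by gcongr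
    have h6 : (1 - τ * κ / 2) * b ^ 2 ≤ (1 - c) * b ^ 2 := by gcongr
    have h7 : (1 + c / 2) * (θ * ‖Φ x y u' - Y x u'‖ ^ 2 + ‖u' - us x‖ ^ 2)
        ≤ (1 + c / 2) * ((1 - c) * (θ * a ^ 2 + b ^ 2)) := by
      gcongr
      linarith
    have h8 : 0 ≤ c ^ 2 / 2 * (θ * a ^ 2 + b ^ 2) := by positivity
    change θ * ‖Φ x y u' - Y x' u'‖ ^ 2 + ‖u' - us x'‖ ^ 2
      ≤ (1 - c / 2) * (θ * a ^ 2 + b ^ 2) + C * ‖x - x'‖ ^ 2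
    nlinarith

/-! ### First-order inequalities for smooth and strongly convex functions -/

section Calculus

variable {H : Type*} [NormedAddCommGroup H] [InnerProductSpace ℝ H] [CompleteSpace H]

theorem hasDerivAt_comp_add_smul {φ : H → ℝ} (hφ : Differentiable ℝ φ) (p v : H) (t : ℝ) :
    HasDerivAt (fun t : ℝ => φ (p + t • v)) (inner ℝ (gradient φ (p + t • v)) v) t := by
  have h1 : HasDerivAt (fun t : ℝ => p + t • v) v t := by
    simpa using ((hasDerivAt_id t).smul_const v).const_add p
  have h2 := ((hφ (p + t • v)).hasGradientAt.hasFDerivAt).comp_hasDerivAt t h1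
  rw [InnerProductSpace.toDual_apply_apply] at h2
  exact h2

/-- A growth bound on the gradient along a segment integrates to a quadratic lower bound. -/
theorem add_inner_gradient_le {φ : H → ℝ} (hφ : Differentiable ℝ φ) {m : ℝ} {p v : H}
    (h : ∀ t : ℝ, 0 ≤ t → m * t * ‖v‖ ^ 2 ≤ inner ℝ (gradient φ (p + t • v) - gradient φ p) v) :
    φ p + inner ℝ (gradient φ p) v + m / 2 * ‖v‖ ^ 2 ≤ φ (p + v) := by
  set ψ : ℝ → ℝ := fun t => φ (p + t • v) - t * inner ℝ (gradient φ p) v - m / 2 * t ^ 2 * ‖v‖ ^ 2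
  have hd : ∀ t, HasDerivAt ψ (inner ℝ (gradient φ (p + t • v)) v - inner ℝ (gradient φ p) v
      - m * t * ‖v‖ ^ 2) t := by
    intro t
    have h1 := ((hasDerivAt_comp_add_smul hφ p v t).sub
      ((hasDerivAt_id t).mul_const (inner ℝ (gradient φ p) v))).sub
      ((((hasDerivAt_id t).pow 2).const_mul (m / 2)).mul_const (‖v‖ ^ 2))
    refine h1.congr_deriv ?_
    simp only [id, Nat.cast_ofNat]
    ring
  have hmono : MonotoneOn ψ (Set.Icc 0 1) := by
    refine monotoneOn_of_deriv_nonneg (convex_Icc 0 1)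
      (fun t _ => (hd t).continuousAt.continuousWithinAt)
      (fun t _ => (hd t).differentiableAt.differentiableWithinAt) fun t ht => ?_
    rw [interior_Icc] at ht
    rw [(hd t).deriv]
    have := h t ht.1.le
    rw [inner_sub_left] at this
    linarith
  have := hmono (Set.left_mem_Icc.2 zero_le_one) (Set.right_mem_Icc.2 zero_le_one) zero_le_one
  simp only [ψ, zero_smul, add_zero, one_smul] at this
  linarith

/-- The descent lemma. -/
theorem le_add_inner_gradient {φ : H → ℝ} (hφ : Differentiable ℝ φ) {L : ℝ}
    (hL : ∀ p q, ‖gradient φ p - gradient φ q‖ ≤ L * ‖p - q‖) (p v : H) :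
    φ (p + v) ≤ φ p + inner ℝ (gradient φ p) v + L / 2 * ‖v‖ ^ 2 := by
  have hg : ∀ q, gradient (fun p => -φ p) q = -gradient φ q := fun q => by
    refine HasGradientAt.gradient ?_
    rw [hasGradientAt_iff_hasFDerivAt]
    refine (hφ q).hasGradientAt.hasFDerivAt.neg.congr_fderiv ?_
    simp
  -- The upper bound for `φ` is the lower bound for `-φ` with modulus `-L`.
  have h := add_inner_gradient_le (φ := fun p => -φ p) hφ.neg (m := -L) (p := p) (v := v)
    fun t ht => by
      rw [hg, hg]
      have h1 := hL (p + t • v) p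
      rw [add_sub_cancel_left, norm_smul, Real.norm_eq_abs, abs_of_nonneg ht] at h1
      have h2 := real_inner_le_norm (gradient φ (p + t • v) - gradient φ p) v
      have h3 : ‖gradient φ (p + t • v) - gradient φ p‖ * ‖v‖ ≤ L * (t * ‖v‖) * ‖v‖ := by gcongr
      rw [neg_sub_neg, ← neg_sub, inner_neg_left]
      nlinarith
  simp only [hg, inner_neg_left] at h
  linarith

/-- Divide the strong convexity inequality on the segment from `p` to `q` by `t` and let `t`
decrease to `0`. -/
theorem StrongConvexOn.add_inner_gradient_le {φ : H → ℝ} (hφ : Differentiable ℝ φ) {m : ℝ}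
    (h : StrongConvexOn Set.univ m φ) (p q : H) :
    φ p + inner ℝ (gradient φ p) (q - p) + m / 2 * ‖q - p‖ ^ 2 ≤ φ q := by
  have hd := hasDerivAt_comp_add_smul hφ p (q - p) 0
  rw [zero_smul, add_zero] at hd
  have h1 := hd.tendsto_slope_zero_right
  have h2 : Filter.Tendsto (fun t : ℝ => φ q - φ p - (1 - t) * (m / 2 * ‖q - p‖ ^ 2))
      (nhdsWithin 0 (Set.Ioi 0)) (nhds (φ q - φ p - (1 - 0) * (m / 2 * ‖q - p‖ ^ 2))) := by
    refine Filter.Tendsto.mono_left ?_ nhdsWithin_le_nhds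
    exact Continuous.tendsto (by fun_prop) 0
  have h3 := le_of_tendsto_of_tendsto h1 h2 ?_
  · linarith
  · have : Set.Ioo (0 : ℝ) 1 ∈ nhdsWithin 0 (Set.Ioi 0) := Ioo_mem_nhdsGT zero_lt_one
    filter_upwards [this] with t ht
    have h4 := h.2 (Set.mem_univ p) (Set.mem_univ q) (sub_nonneg.2 ht.2.le) ht.1.le
      (sub_add_cancel 1 t)
    have e : (1 - t) • p + t • q = p + t • (q - p) := by module
    rw [e, norm_sub_rev] at h4
    simp only [smul_eq_mul] at h4 ⊢
    rw [zero_add, zero_smul, add_zero, inv_mul_le_iff₀ ht.1]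
    nlinarith

end Calculus

/-! ### The joint space and regular objectives -/

theorem norm_pair_sq {m n : ℕ} (x : Vec m) (y : Vec n) : ‖pair x y‖ ^ 2 = ‖x‖ ^ 2 + ‖y‖ ^ 2 :=
  WithLp.prod_norm_sq_eq_of_L2 _

theorem norm_pair_le {m n : ℕ} (x : Vec m) (y : Vec n) : ‖pair x y‖ ≤ ‖x‖ + ‖y‖ := by
  refine le_of_sq_le_sq ?_ (by positivity)
  rw [norm_pair_sq]
  nlinarith [mul_nonneg (norm_nonneg x) (norm_nonneg y)]

theorem WithLp.norm_fst_le_norm {m n : ℕ} (p : Joint m n) : ‖p.fst‖ ≤ ‖p‖ := by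
  refine le_of_sq_le_sq ?_ (norm_nonneg _)
  rw [WithLp.prod_norm_sq_eq_of_L2]
  nlinarith [sq_nonneg ‖p.snd‖]

theorem WithLp.norm_snd_le_norm {m n : ℕ} (p : Joint m n) : ‖p.snd‖ ≤ ‖p‖ := by
  refine le_of_sq_le_sq ?_ (norm_nonneg _)
  rw [WithLp.prod_norm_sq_eq_of_L2]
  nlinarith [sq_nonneg ‖p.fst‖]

theorem pair_sub {m n : ℕ} (x x' : Vec m) (y y' : Vec n) :
    pair x y - pair x' y' = pair (x - x') (y - y') := rfl

theorem inner_pair {m n : ℕ} (p : Joint m n) (x : Vec m) (y : Vec n) :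
    inner ℝ p (pair x y) = inner ℝ p.fst x + inner ℝ p.snd y := rfl

/-- An objective with `L`-Lipschitz gradient whose second-block gradient is `m`-strongly
monotone in the second block. -/
structure Regular {dx dy : ℕ} (φ : Joint dx dy → ℝ) (L m : ℝ) : Prop where
  differentiable : Differentiable ℝ φ
  lipschitz : ∀ p q, ‖gradient φ p - gradient φ q‖ ≤ L * ‖p - q‖
  monotone : ∀ x y y', m * ‖y - y'‖ ^ 2
    ≤ inner ℝ ((gradient φ (pair x y)).snd - (gradient φ (pair x y')).snd) (y - y')

namespace Regular

variable {dx dy : ℕ} {φ : Joint dx dy → ℝ} {L m : ℝ}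

theorem norm_gradient_sub_le (H : Regular φ L m) (hL : 0 ≤ L) (x x' : Vec dx) (y y' : Vec dy) :
    ‖gradient φ (pair x y) - gradient φ (pair x' y')‖ ≤ L * (‖x - x'‖ + ‖y - y'‖) := by
  refine (H.lipschitz _ _).trans ?_
  gcongr
  exact norm_pair_le _ _

theorem norm_fst_sub_le (H : Regular φ L m) (hL : 0 ≤ L) (x x' : Vec dx) (y y' : Vec dy) :
    ‖(gradient φ (pair x y)).fst - (gradient φ (pair x' y')).fst‖
      ≤ L * (‖x - x'‖ + ‖y - y'‖) :=
  (WithLp.norm_fst_le_norm (gradient φ (pair x y) - gradient φ (pair x' y'))).trans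
    (H.norm_gradient_sub_le hL x x' y y')

theorem norm_snd_sub_le (H : Regular φ L m) (hL : 0 ≤ L) (x x' : Vec dx) (y y' : Vec dy) :
    ‖(gradient φ (pair x y)).snd - (gradient φ (pair x' y')).snd‖
      ≤ L * (‖x - x'‖ + ‖y - y'‖) :=
  (WithLp.norm_snd_le_norm (gradient φ (pair x y) - gradient φ (pair x' y'))).trans
    (H.norm_gradient_sub_le hL x x' y y')

theorem add_inner_le (H : Regular φ L m) (x : Vec dx) (y y' : Vec dy) :
    φ (pair x y) + inner ℝ (gradient φ (pair x y)).snd (y' - y) + m / 2 * ‖y' - y‖ ^ 2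
      ≤ φ (pair x y') := by
  have hg : ∀ y, gradient (fun y => φ (pair x y)) y = (gradient φ (pair x y)).snd := fun y =>
    (hasGradientAt_comp_pair_right H.differentiable x y).gradient
  have hd : Differentiable ℝ fun y => φ (pair x y) := fun y =>
    (hasGradientAt_comp_pair_right H.differentiable x y).differentiableAt
  have h := add_inner_gradient_le hd (m := m) (p := y) (v := y' - y) fun t ht => by
    rw [hg, hg]
    rcases ht.eq_or_lt with rfl | ht
    · simp
    have h1 := H.monotone x (y + t • (y' - y)) y
    rw [add_sub_cancel_left, norm_smul, inner_smul_right, Real.norm_eq_abs, abs_of_pos ht] at h1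
    refine le_of_mul_le_mul_left ?_ ht
    linarith
  rwa [add_sub_cancel, hg] at h

theorem le_add_inner (H : Regular φ L m) (x v : Vec dx) (y w : Vec dy) :
    φ (pair (x + v) (y + w)) ≤ φ (pair x y) + (inner ℝ (gradient φ (pair x y)).fst v
      + inner ℝ (gradient φ (pair x y)).snd w) + L / 2 * (‖v‖ ^ 2 + ‖w‖ ^ 2) := by
  have h := le_add_inner_gradient H.differentiable H.lipschitz (pair x y) (pair v w)
  rwa [inner_pair, norm_pair_sq] at h

end Regular

namespace LinBilevel

variable {dx dy dh : ℕ} {B : Matrix (Fin dh) (Fin dx) ℝ} {A : Matrix (Fin dh) (Fin dy) ℝ}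
  {P : LinBilevel B A} {lf0 lf1 lg1 : ℝ≥0} {μg : ℝ}

theorem Assumptions.monotone_g (H : P.Assumptions lf0 lf1 lg1 μg) (x : Vec dx) (y y' : Vec dy) :
    μg * ‖y - y'‖ ^ 2
      ≤ inner ℝ ((gradient P.g (pair x y)).snd - (gradient P.g (pair x y')).snd) (y - y') := by
  have hd := H.contDiff_g.differentiable one_ne_zero
  have hg : ∀ y, gradient (fun y => P.g (pair x y)) y = (gradient P.g (pair x y)).snd := fun y =>
    (hasGradientAt_comp_pair_right hd x y).gradient
  have hd' : Differentiable ℝ fun y => P.g (pair x y) := fun y =>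
    (hasGradientAt_comp_pair_right hd x y).differentiableAt
  have h1 := (H.strongConvex_g x).add_inner_gradient_le hd' y y'
  have h2 := (H.strongConvex_g x).add_inner_gradient_le hd' y' y
  rw [hg] at h1 h2
  rw [← neg_sub y y', inner_neg_right, norm_neg] at h1
  rw [inner_sub_left]
  linarith

/-- The constants are deliberately weakened: `δ f + g` satisfies the same ones, so a single choice
of step sizes fits both blocks. -/
theorem Assumptions.regular_g (H : P.Assumptions lf0 lf1 lg1 μg) (hμ : 0 < μg) :
    Regular P.g (lg1 + μg / 2) (μg / 2) where
  differentiable := H.contDiff_g.differentiable one_ne_zero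
  lipschitz p q := by
    have := H.lipschitz_grad_g.dist_le_mul p q
    rw [dist_eq_norm, dist_eq_norm] at this
    nlinarith [norm_nonneg (p - q)]
  monotone x y y' := by
    refine le_trans ?_ (H.monotone_g x y y')
    gcongr
    linarith

theorem gradient_penalised (hf : Differentiable ℝ P.f) (hg : Differentiable ℝ P.g) (δ : ℝ)
    (p : Joint dx dy) :
    gradient (fun p => δ * P.f p + P.g p) p = δ • gradient P.f p + gradient P.g p := by
  refine HasGradientAt.gradient ?_
  rw [hasGradientAt_iff_hasFDerivAt]
  refine (((hf p).hasGradientAt.hasFDerivAt.const_mul δ).add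
    (hg p).hasGradientAt.hasFDerivAt).congr_fderiv ?_
  simp

/-- Since `δ l_{f,1} ≤ μ_g / 2`, the term `δ ∇f` is `μ_g / 2`-Lipschitz: it costs at most half of
the strong monotonicity and adds at most `μ_g / 2` to the Lipschitz constant. -/
theorem Assumptions.regular_penalised (H : P.Assumptions lf0 lf1 lg1 μg) {δ : ℝ} (hδ : 0 ≤ δ)
    (hδ' : 2 * lf1 * δ ≤ μg) :
    Regular (fun p => δ * P.f p + P.g p) (lg1 + μg / 2) (μg / 2) := by
  have hf := H.contDiff_f.differentiable one_ne_zero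
  have hg := H.contDiff_g.differentiable one_ne_zero
  have hlip : ∀ p q, ‖gradient P.f p - gradient P.f q‖ ≤ lf1 * ‖p - q‖ := fun p q => by
    simpa [dist_eq_norm] using H.lipschitz_grad_f.dist_le_mul p q
  refine ⟨(hf.const_mul δ).add hg, fun p q => ?_, fun x y y' => ?_⟩
  · rw [gradient_penalised hf hg, gradient_penalised hf hg]
    have e : δ • gradient P.f p + gradient P.g p - (δ • gradient P.f q + gradient P.g q)
        = δ • (gradient P.f p - gradient P.f q) + (gradient P.g p - gradient P.g q) := by
      rw [smul_sub]; abel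
    rw [e]
    have h1 := H.lipschitz_grad_g.dist_le_mul p q
    rw [dist_eq_norm, dist_eq_norm] at h1
    refine (norm_add_le _ _).trans ?_
    rw [norm_smul, Real.norm_eq_abs, abs_of_nonneg hδ]
    have h2 : δ * ‖gradient P.f p - gradient P.f q‖ ≤ δ * (lf1 * ‖p - q‖) := by
      gcongr; exact hlip p q
    nlinarith [norm_nonneg (p - q)]
  · rw [gradient_penalised hf hg, gradient_penalised hf hg]
    have e : (δ • gradient P.f (pair x y) + gradient P.g (pair x y)).snd
        - (δ • gradient P.f (pair x y') + gradient P.g (pair x y')).snd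
        = δ • (gradient P.f (pair x y) - gradient P.f (pair x y')).snd
          + ((gradient P.g (pair x y)).snd - (gradient P.g (pair x y')).snd) := by
      simp only [WithLp.add_snd, WithLp.smul_snd, WithLp.sub_snd, smul_sub]; abel
    rw [e, inner_add_left, real_inner_smul_left]
    have h1 := H.monotone_g x y y'
    have h2 : ‖(gradient P.f (pair x y) - gradient P.f (pair x y')).snd‖ ≤ lf1 * ‖y - y'‖ := by
      refine ((WithLp.norm_snd_le_norm _).trans (hlip _ _)).trans ?_
      gcongr
      simpa [pair_sub] using norm_pair_le (x - x) (y - y')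
    have h3 := abs_le.1 (abs_real_inner_le_norm
      (gradient P.f (pair x y) - gradient P.f (pair x y')).snd (y - y'))
    have h4 : ‖(gradient P.f (pair x y) - gradient P.f (pair x y')).snd‖ * ‖y - y'‖
        ≤ lf1 * ‖y - y'‖ * ‖y - y'‖ := by gcongr
    have h5 : δ * -(lf1 * ‖y - y'‖ * ‖y - y'‖)
        ≤ δ * inner ℝ (gradient P.f (pair x y) - gradient P.f (pair x y')).snd (y - y') := by
      gcongr; linarith
    nlinarith [sq_nonneg ‖y - y'‖]

end LinBilevel

/-! ### Full row rank and projections onto orthants -/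

theorem norm_toEuclideanLin_le {m n : ℕ} (M : Matrix (Fin m) (Fin n) ℝ) (v : Vec n) :
    ‖M.toEuclideanLin v‖ ≤ ‖M‖ * ‖v‖ :=
  M.l2_opNorm_mulVec v

theorem norm_transpose_toEuclideanLin_le {m n : ℕ} (M : Matrix (Fin m) (Fin n) ℝ) (v : Vec m) :
    ‖Mᵀ.toEuclideanLin v‖ ≤ ‖M‖ * ‖v‖ := by
  have h := norm_toEuclideanLin_le Mᵀ v
  rwa [← Matrix.conjTranspose_eq_transpose_of_trivial, Matrix.l2_opNorm_conjTranspose,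
    Matrix.conjTranspose_eq_transpose_of_trivial] at h

/-- A bounded right inverse of a matrix of full row rank. -/
theorem exists_rightInverse_of_rank_eq {m n : ℕ} {A : Matrix (Fin m) (Fin n) ℝ}
    (hA : A.rank = m) :
    ∃ (S : Vec m →ₗ[ℝ] Vec n) (s : ℝ), 0 < s ∧ (∀ w, A.toEuclideanLin (S w) = w) ∧
      ∀ w, ‖S w‖ ≤ s * ‖w‖ := by
  have hsurj : LinearMap.range A.toEuclideanLin = ⊤ := by
    apply Submodule.eq_top_of_finrank_eq
    rw [Matrix.toEuclideanLin_eq_toLin_orthonormal, ← Matrix.rank_eq_finrank_range_toLin A (EuclideanSpace.basisFun _ ℝ).toBasis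
      (EuclideanSpace.basisFun _ ℝ).toBasis, hA]
    simp
  obtain ⟨S, hS⟩ := A.toEuclideanLin.exists_rightInverse_of_surjective hsurj
  refine ⟨S, ‖LinearMap.toContinuousLinearMap S‖ + 1, by positivity,
    fun w => LinearMap.congr_fun hS w, fun w => ?_⟩
  have := (LinearMap.toContinuousLinearMap S).le_opNorm w
  simp only [LinearMap.coe_toContinuousLinearMap'] at this
  linarith [norm_nonneg w]

/-- `‖w‖² = ⟨w, A S w⟩ = ⟨Aᵀ w, S w⟩`. This is how full row rank enters: it recovers a multiplier
from the gradient that it balances. -/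
theorem norm_le_of_rightInverse {m n : ℕ} {A : Matrix (Fin m) (Fin n) ℝ} {S : Vec m →ₗ[ℝ] Vec n}
    {s : ℝ} (hS : ∀ w, A.toEuclideanLin (S w) = w) (hs : ∀ w, ‖S w‖ ≤ s * ‖w‖) (w : Vec m) :
    ‖w‖ ≤ s * ‖Aᵀ.toEuclideanLin w‖ := by
  rcases (norm_nonneg w).eq_or_lt with h0 | h0
  · rw [norm_eq_zero.1 h0.symm]; simp
  have h1 := real_inner_le_norm (Aᵀ.toEuclideanLin w) (S w)
  rw [inner_transpose_toEuclideanLin, hS, real_inner_self_eq_norm_sq] at h1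
  have h2 := mul_le_mul_of_nonneg_left (hs w) (norm_nonneg (Aᵀ.toEuclideanLin w))
  refine le_of_mul_le_mul_right ?_ h0
  linarith

theorem inner_vec {n : ℕ} (u w : Vec n) : inner ℝ u w = ∑ i, u i * w i := by
  simp [PiLp.inner_apply, mul_comm]

/-- The second term on the left is what later absorbs the displacement of the dual iterate; plain
nonexpansiveness would not suffice there. -/
theorem projNonneg_firm {n : ℕ} (a b : Vec n) :
    ‖projNonneg a - projNonneg b‖ ^ 2 + ‖(a - projNonneg a) - (b - projNonneg b)‖ ^ 2
      ≤ ‖a - b‖ ^ 2 := by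
  simp only [EuclideanSpace.real_norm_sq_eq, ← Finset.sum_add_distrib]
  refine Finset.sum_le_sum fun i _ => ?_
  simp only [PiLp.sub_apply, projNonneg]
  rcases le_total (a i) 0 with h1 | h1 <;> rcases le_total (b i) 0 with h2 | h2 <;>
    simp only [h1, h2, max_eq_left, max_eq_right] <;> nlinarith

theorem norm_projNonpos_sub_le {n : ℕ} (a b : Vec n) :
    ‖projNonpos a - projNonpos b‖ ≤ ‖a - b‖ := by
  refine le_of_sq_le_sq ?_ (norm_nonneg _)
  simp only [EuclideanSpace.real_norm_sq_eq]
  refine Finset.sum_le_sum fun i _ => ?_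
  simp only [PiLp.sub_apply, projNonpos]
  rcases le_total (a i) 0 with h1 | h1 <;> rcases le_total (b i) 0 with h2 | h2 <;>
    simp only [h1, h2, min_eq_left, min_eq_right] <;> nlinarith

/-- A fixed point of a projected step onto the nonpositive orthant is complementary to the
direction of the step. -/
theorem projNonpos_fixed {n : ℕ} {a p : Vec n} {η : ℝ} (hη : 0 < η)
    (h : projNonpos (a + η • p) = a) (i : Fin n) : a i ≤ 0 ∧ 0 ≤ p i ∧ p i * a i = 0 := by
  have hi : min (a i + η * p i) 0 = a i := congrArg (fun v : Vec n => v i) h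
  rcases le_total (a i + η * p i) 0 with h1 | h1
  · rw [min_eq_left h1] at hi
    have h2 : p i = 0 := by
      have : η * p i = 0 := by linarith
      exact (mul_eq_zero.1 this).resolve_left hη.ne'
    rw [h2] at h1 ⊢
    exact ⟨by linarith, le_rfl, by simp⟩
  · rw [min_eq_right h1] at hi
    rw [← hi] at h1 ⊢
    refine ⟨le_rfl, ?_, by simp⟩
    rw [zero_add] at h1
    exact nonneg_of_mul_nonneg_right h1 hη

theorem projNonneg_fixed {n : ℕ} {a p : Vec n} {η : ℝ} (hη : 0 < η)
    (h : projNonneg (a + η • p) = a) (i : Fin n) : 0 ≤ a i ∧ p i ≤ 0 ∧ a i * p i = 0 := by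
  have hi : max (a i + η * p i) 0 = a i := congrArg (fun v : Vec n => v i) h
  rcases le_total (a i + η * p i) 0 with h1 | h1
  · rw [max_eq_right h1] at hi
    rw [← hi] at h1 ⊢
    refine ⟨le_rfl, ?_, by simp⟩
    rw [zero_add] at h1
    exact nonpos_of_mul_nonpos_right h1 hη
  · rw [max_eq_left h1] at hi
    have h2 : p i = 0 := by
      have : η * p i = 0 := by linarith
      exact (mul_eq_zero.1 this).resolve_left hη.ne'
    rw [h2] at h1 ⊢
    exact ⟨by linarith, le_rfl, by simp⟩

/-- Monotonicity of the normal cone: in each coordinate the diagonal products vanish and the mixed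
ones, `-p a'` and `-p' a`, are nonnegative. -/
theorem inner_sub_nonneg_of_complementary {n : ℕ} {p p' a a' : Vec n}
    (h : ∀ i, a i ≤ 0 ∧ 0 ≤ p i ∧ p i * a i = 0) (h' : ∀ i, a' i ≤ 0 ∧ 0 ≤ p' i ∧ p' i * a' i = 0) :
    0 ≤ inner ℝ (p - p') (a - a') := by
  rw [inner_vec]
  refine Finset.sum_nonneg fun i _ => ?_
  obtain ⟨h1, h2, h3⟩ := h i
  obtain ⟨h4, h5, h6⟩ := h' i
  simp only [PiLp.sub_apply]
  nlinarith [mul_nonneg h2 (neg_nonneg.2 h4), mul_nonneg h5 (neg_nonneg.2 h1)]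

/-! ### KKT pairs: optimality, stability and duality -/

namespace LinBilevel

variable {dx dy dh : ℕ} {B : Matrix (Fin dh) (Fin dx) ℝ} {A : Matrix (Fin dh) (Fin dy) ℝ}
  {P : LinBilevel B A} {φ φ' : Joint dx dy → ℝ} {L m s : ℝ} {x : Vec dx} {y y' : Vec dy}
  {u u' : Vec dh} {S : Vec dh →ₗ[ℝ] Vec dy}

theorem h_sub (P : LinBilevel B A) (x x' : Vec dx) (y y' : Vec dy) :
    P.h x y - P.h x' y' = B.toEuclideanLin (x - x') + A.toEuclideanLin (y - y') := by
  simp only [h, map_sub]; abel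

theorem norm_h_sub_le (P : LinBilevel B A) (x x' : Vec dx) (y y' : Vec dy) :
    ‖P.h x y - P.h x' y'‖ ≤ ‖B‖ * ‖x - x'‖ + ‖A‖ * ‖y - y'‖ := by
  rw [h_sub]
  exact (norm_add_le _ _).trans
    (add_le_add (norm_toEuclideanLin_le _ _) (norm_toEuclideanLin_le _ _))

/-- The Karush-Kuhn-Tucker conditions for the minimisation of `φ (x, ·)` over `𝒴(x)`. -/
structure KKT (P : LinBilevel B A) (φ : Joint dx dy → ℝ) (x : Vec dx) (y : Vec dy)
    (u : Vec dh) : Prop where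
  stationary : (gradient φ (pair x y)).snd + Aᵀ.toEuclideanLin u = 0
  complementary : ∀ i, P.h x y i ≤ 0 ∧ 0 ≤ u i ∧ u i * P.h x y i = 0

namespace KKT

theorem mem_feas (K : P.KKT φ x y u) : y ∈ P.feas x := fun i => (K.complementary i).1

theorem inner_h (K : P.KKT φ x y u) : inner ℝ u (P.h x y) = 0 := by
  rw [inner_vec]
  exact Finset.sum_eq_zero fun i _ => (K.complementary i).2.2

theorem gradient_eq (K : P.KKT φ x y u) : (gradient φ (pair x y)).snd = -Aᵀ.toEuclideanLin u :=
  eq_neg_of_add_eq_zero_left K.stationary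

theorem inner_gradient (K : P.KKT φ x y u) (w : Vec dy) :
    inner ℝ (gradient φ (pair x y)).snd w = -inner ℝ u (A.toEuclideanLin w) := by
  rw [K.gradient_eq, inner_neg_left, inner_transpose_toEuclideanLin]

/-- Stationarity converts the linear term of the strong convexity inequality at `y` into `-⟨u, h (x,
z) - h (x, y)⟩`, and complementarity removes `⟨u, h (x, y)⟩`. -/
theorem le_lagrangian (K : P.KKT φ x y u) (H : Regular φ L m) (z : Vec dy) :
    φ (pair x y) + m / 2 * ‖z - y‖ ^ 2 ≤ φ (pair x z) + inner ℝ u (P.h x z) := by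
  have h1 := H.add_inner_le x y z
  have h2 : A.toEuclideanLin (z - y) = P.h x z - P.h x y := by simp [h_sub]
  rw [K.inner_gradient, h2, inner_sub_right, K.inner_h] at h1
  linarith

theorem inner_nonpos (K : P.KKT φ x y u) {z : Vec dy} (hz : z ∈ P.feas x) :
    inner ℝ u (P.h x z) ≤ 0 := by
  rw [inner_vec]
  exact Finset.sum_nonpos fun i _ => mul_nonpos_of_nonneg_of_nonpos (K.complementary i).2.1 (hz i)

theorem le_of_mem_feas (K : P.KKT φ x y u) (H : Regular φ L m) {z : Vec dy} (hz : z ∈ P.feas x) :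
    φ (pair x y) + m / 2 * ‖z - y‖ ^ 2 ≤ φ (pair x z) := by
  linarith [K.le_lagrangian H z, K.inner_nonpos hz]

theorem isMinimizer (K : P.KKT φ x y u) (H : Regular φ L m) (hm : 0 < m) :
    IsMinimizer (P.feas x) (fun y => φ (pair x y)) y := by
  refine ⟨K.mem_feas, fun z hz => ?_⟩
  have h1 := K.le_of_mem_feas H hz
  have h2 : 0 ≤ m / 2 * ‖z - y‖ ^ 2 := by positivity
  change φ (pair x y) ≤ φ (pair x z)
  linarith

theorem eq_of_isMinimizer (K : P.KKT φ x y u) (H : Regular φ L m) (hm : 0 < m) {z : Vec dy}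
    (hz : IsMinimizer (P.feas x) (fun y => φ (pair x y)) z) : z = y := by
  have h1 := K.le_of_mem_feas H hz.1
  have h2 : φ (pair x z) ≤ φ (pair x y) := hz.2 K.mem_feas
  have h3 : m / 2 * ‖z - y‖ ^ 2 ≤ 0 := by linarith
  have h4 : ‖z - y‖ ^ 2 ≤ 0 := nonpos_of_mul_nonpos_right h3 (by positivity)
  have h5 : ‖z - y‖ = 0 := by nlinarith [norm_nonneg (z - y)]
  exact sub_eq_zero.1 (norm_eq_zero.1 h5)

theorem existsUnique_isMinimizer (K : P.KKT φ x y u) (H : Regular φ L m) (hm : 0 < m) :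
    ∃! y, IsMinimizer (P.feas x) (fun y => φ (pair x y)) y :=
  ⟨y, K.isMinimizer H hm, fun _ hz => K.eq_of_isMinimizer H hm hz⟩

theorem argminOn_eq (K : P.KKT φ x y u) (H : Regular φ L m) (hm : 0 < m) :
    argminOn (P.feas x) (fun y => φ (pair x y)) = y :=
  K.eq_of_isMinimizer H hm (Classical.epsilon_spec ⟨y, K.isMinimizer H hm⟩)

/-- Stability of the solution under a perturbation of the objective. -/
theorem norm_sub_le (K : P.KKT φ x y u) (K' : P.KKT φ' x y' u') (H : Regular φ L m) :
    m * ‖y - y'‖ ≤ ‖(gradient φ (pair x y')).snd - (gradient φ' (pair x y')).snd‖ := by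
  have h1 := inner_sub_nonneg_of_complementary K.complementary K'.complementary
  have h2 : P.h x y - P.h x y' = A.toEuclideanLin (y - y') := by simp [h_sub]
  rw [h2, ← inner_transpose_toEuclideanLin, map_sub,
    ← neg_eq_iff_eq_neg.2 K.gradient_eq, ← neg_eq_iff_eq_neg.2 K'.gradient_eq] at h1
  -- Complementarity makes the pairing of `∇φ(y) - ∇φ'(y')` with `y - y'` nonpositive, so strong
  -- monotonicity of `∇φ` is paid for by `∇φ' - ∇φ` at the single point `y'`.
  have h3 := H.monotone x y y'
  have h4 := real_inner_le_norm
    ((gradient φ' (pair x y')).snd - (gradient φ (pair x y')).snd) (y - y')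
  rw [norm_sub_rev (gradient φ' (pair x y')).snd] at h4
  simp only [inner_sub_left, inner_neg_left] at h1 h3 h4
  rcases (norm_nonneg (y - y')).eq_or_lt with h0 | h0
  · rw [← h0, mul_zero]; exact norm_nonneg _
  · refine le_of_mul_le_mul_right ?_ h0
    linarith

/-- By stationarity `Aᵀ (u - u')` is a difference of gradients, and `Aᵀ` is bounded below. -/
theorem norm_multiplier_sub_le (K : P.KKT φ x y u) (K' : P.KKT φ' x y' u') (H : Regular φ L m)
    (hL : 0 ≤ L) (hs0 : 0 ≤ s) (hS : ∀ w, A.toEuclideanLin (S w) = w)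
    (hs : ∀ w, ‖S w‖ ≤ s * ‖w‖) :
    ‖u - u'‖ ≤ s * (L * ‖y - y'‖
      + ‖(gradient φ (pair x y')).snd - (gradient φ' (pair x y')).snd‖) := by
  refine (norm_le_of_rightInverse hS hs _).trans ?_
  gcongr
  rw [map_sub, ← neg_eq_iff_eq_neg.2 K.gradient_eq, ← neg_eq_iff_eq_neg.2 K'.gradient_eq,
    neg_sub_neg, norm_sub_rev]
  refine (norm_sub_le_norm_sub_add_norm_sub _ (gradient φ (pair x y')).snd _).trans ?_
  gcongr
  simpa using H.norm_snd_sub_le hL x x y y'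

/-- A real `⨅` over an unbounded family is `0`, so this bound is needed before `dual` can be
compared with values of the Lagrangian. It follows by completing the square around `z = 0`. -/
theorem bddBelow_lagrangian (H : Regular P.g L m) (hm : 0 < m) (x : Vec dx) (w : Vec dh) :
    BddBelow (Set.range fun z : Vec dy => P.g (pair x z) + inner ℝ w (P.h x z)) := by
  set c := (gradient P.g (pair x 0)).snd + Aᵀ.toEuclideanLin w with hc
  refine ⟨P.g (pair x 0) + inner ℝ w (P.h x 0) - ‖c‖ ^ 2 / (2 * m), ?_⟩
  rintro _ ⟨z, rfl⟩
  have h1 := H.add_inner_le x 0 z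
  have h2 : P.h x z = P.h x 0 + A.toEuclideanLin z := by simp only [h, map_zero]; abel
  have h3 := (abs_le.1 (abs_real_inner_le_norm c z)).1
  rw [hc, inner_add_left, inner_transpose_toEuclideanLin, ← hc] at h3
  simp only [sub_zero] at h1
  have h4 : 0 ≤ (‖c‖ - m * ‖z‖) ^ 2 / (2 * m) := by positivity
  have h5 : (‖c‖ - m * ‖z‖) ^ 2 / (2 * m)
      = ‖c‖ ^ 2 / (2 * m) - ‖c‖ * ‖z‖ + m / 2 * ‖z‖ ^ 2 := by field_simp; ring
  simp only [h2, inner_add_right]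
  linarith

/-- Strong duality and uniqueness of the multiplier. -/
theorem isMultiplier_iff (K : P.KKT P.g x y u) (H : Regular P.g L m) (hm : 0 < m)
    (hS : ∀ w, A.toEuclideanLin (S w) = w) (hs : ∀ w, ‖S w‖ ≤ s * ‖w‖) {v : Vec dh} :
    P.IsMultiplier x v ↔ v = u := by
  have hle : ∀ w z, P.dual x w ≤ P.g (pair x z) + inner ℝ w (P.h x z) := fun w z =>
    ciInf_le (bddBelow_lagrangian H hm x w) z
  have hu : P.g (pair x y) ≤ P.dual x u := le_ciInf fun z => by
    have h1 := K.le_lagrangian H z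
    have h2 : 0 ≤ m / 2 * ‖z - y‖ ^ 2 := by positivity
    linarith
  have hneg : ∀ w : Vec dh, (∀ i, 0 ≤ w i) → inner ℝ w (P.h x y) ≤ 0 := fun w hw => by
    rw [inner_vec]
    exact Finset.sum_nonpos fun i _ => mul_nonpos_of_nonneg_of_nonpos (hw i) (K.mem_feas i)
  constructor
  · rintro ⟨hv, hmax⟩
    -- Optimality of `v` gives `g (x, y) ≤ dual u ≤ dual v`, so `y` minimises the Lagrangian of `v`
    -- over the whole space. Its first-order condition yields `Aᵀ v = Aᵀ u`, hence `v = u`. The zero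
    -- penalty only puts the function in the form of `hasGradientAt_penalty`.
    have hmin : IsMinOn (fun z => P.g (pair x z)
        + (inner ℝ v (P.h x z) + 0 / 2 * ‖P.h x z‖ ^ 2)) Set.univ y := fun z _ => by
      have h1 := hmax u fun i => (K.complementary i).2.1
      have h2 := hle v z
      have h3 := hneg v hv
      change P.g (pair x y) + (inner ℝ v (P.h x y) + 0 / 2 * ‖P.h x y‖ ^ 2)
        ≤ P.g (pair x z) + (inner ℝ v (P.h x z) + 0 / 2 * ‖P.h x z‖ ^ 2)
      simp only [zero_div, zero_mul, add_zero]
      linarith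
    have hg1 := hasGradientAt_comp_pair_right H.differentiable x y
    have hg2 := hasGradientAt_penalty A (fun z => P.h x z) (B.toEuclideanLin x - P.b)
      (fun z => by simp only [h]; abel) v 0 y
    rw [hasGradientAt_iff_hasFDerivAt] at hg1 hg2
    have h0 := (hmin.isLocalMin Filter.univ_mem).hasFDerivAt_eq_zero (hg1.add hg2)
    rw [← map_add, LinearIsometryEquiv.map_eq_zero_iff, zero_smul, add_zero, K.gradient_eq,
      neg_add_eq_zero] at h0
    have h1 := norm_le_of_rightInverse hS hs (v - u)
    rw [map_sub, h0, sub_self, norm_zero, mul_zero] at h1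
    exact sub_eq_zero.1 (norm_le_zero_iff.1 h1)
  · rintro rfl
    refine ⟨fun i => (K.complementary i).2.1, fun w hw => ?_⟩
    have h1 := hle w y
    have h2 := hneg w hw
    linarith

end KKT

/-! ### Envelope theorem for the optimal value -/

/-- Envelope theorem, with a quadratic error bound that is uniform over the data. -/
theorem exists_envelope_bound (B : Matrix (Fin dh) (Fin dx) ℝ) {A : Matrix (Fin dh) (Fin dy) ℝ}
    (hA : A.rank = dh) {L C : ℝ} (hL : 0 ≤ L) (hC : 0 ≤ C) :
    ∃ E : ℝ, 0 < E ∧ ∀ (P : LinBilevel B A) (φ : Joint dx dy → ℝ) (m : ℝ) (ys : Vec dx → Vec dy)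
      (us : Vec dx → Vec dh), Regular φ L m → 0 < m → (∀ x, P.KKT φ x (ys x) (us x)) →
      (∀ x x', ‖ys x - ys x'‖ ≤ C * ‖x - x'‖) → (∀ x x', ‖us x - us x'‖ ≤ C * ‖x - x'‖) →
      ∀ x x', |φ (pair x' (ys x')) - φ (pair x (ys x))
        - inner ℝ ((gradient φ (pair x (ys x))).fst + Bᵀ.toEuclideanLin (us x)) (x' - x)|
        ≤ E * ‖x' - x‖ ^ 2 := by
  obtain ⟨S, s, hs0, hS, hs⟩ := exists_rightInverse_of_rank_eq hA
  refine ⟨L / 2 * (1 + (s * ‖B‖) ^ 2) + (L * (1 + C) + ‖B‖ * C) + 1, by positivity,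
    fun P φ m ys us H hm K hy hu x x' => ?_⟩
  set G : Vec dx → Vec dx := fun x => (gradient φ (pair x (ys x))).fst + Bᵀ.toEuclideanLin (us x)
    with hG
  have hup : ∀ x x', φ (pair x' (ys x')) ≤ φ (pair x (ys x)) + inner ℝ (G x) (x' - x)
      + L / 2 * (1 + (s * ‖B‖) ^ 2) * ‖x' - x‖ ^ 2 := by
    intro x x'
    -- The shift `w` compensates the change of `x` in the constraint, so `ys x + w` has the same
    -- constraint values at `x'` and is a feasible competitor. By stationarity its linear cost is
    -- `⟨us x, B (x' - x)⟩`.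
    set w : Vec dy := -S (B.toEuclideanLin (x' - x)) with hw
    have hAw : A.toEuclideanLin w = -B.toEuclideanLin (x' - x) := by rw [hw, map_neg, hS]
    have hfeas : ys x + w ∈ P.feas x' := by
      intro i
      have e : P.h x' (ys x + w) = P.h x (ys x) := by
        rw [← sub_eq_zero, h_sub, add_sub_cancel_left, hAw, add_neg_cancel]
      rw [e]
      exact (K x).mem_feas i
    have h1 := (K x').isMinimizer H hm |>.2 hfeas
    have h2 := H.le_add_inner x (x' - x) (ys x) w
    rw [add_sub_cancel, (K x).inner_gradient, hAw, inner_neg_right, neg_neg] at h2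
    have h3 : ‖w‖ ≤ s * ‖B‖ * ‖x' - x‖ := by
      rw [hw, norm_neg, mul_assoc]
      exact (hs _).trans (by gcongr; exact norm_toEuclideanLin_le _ _)
    have h4 : ‖w‖ ^ 2 ≤ (s * ‖B‖ * ‖x' - x‖) ^ 2 := pow_le_pow_left₀ (norm_nonneg _) h3 2
    have h5 : L / 2 * (‖x' - x‖ ^ 2 + ‖w‖ ^ 2)
        ≤ L / 2 * (‖x' - x‖ ^ 2 + (s * ‖B‖ * ‖x' - x‖) ^ 2) := by gcongr
    have h6 : inner ℝ (G x) (x' - x) = inner ℝ (gradient φ (pair x (ys x))).fst (x' - x)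
        + inner ℝ (us x) (B.toEuclideanLin (x' - x)) := by
      rw [hG, inner_add_left, inner_transpose_toEuclideanLin]
    change φ (pair x' (ys x')) ≤ φ (pair x' (ys x + w)) at h1
    linarith
  -- The matching lower bound is the upper bound with `x` and `x'` exchanged; Lipschitz continuity
  -- of `G` moves its linear term back to `x`.
  have hGL : ‖G x' - G x‖ ≤ (L * (1 + C) + ‖B‖ * C) * ‖x' - x‖ := by
    have e : G x' - G x = ((gradient φ (pair x' (ys x'))).fst - (gradient φ (pair x (ys x))).fst)
        + Bᵀ.toEuclideanLin (us x' - us x) := by simp only [hG, map_sub]; abel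
    rw [e]
    refine (norm_add_le _ _).trans ?_
    have h1 := H.norm_fst_sub_le hL x' x (ys x') (ys x)
    have h2 : L * (‖x' - x‖ + ‖ys x' - ys x‖) ≤ L * (‖x' - x‖ + C * ‖x' - x‖) := by
      gcongr; exact hy x' x
    have h3 := norm_transpose_toEuclideanLin_le B (us x' - us x)
    have h4 : ‖B‖ * ‖us x' - us x‖ ≤ ‖B‖ * (C * ‖x' - x‖) := by gcongr; exact hu x' x
    linarith
  have h1 := hup x x'
  have h2 := hup x' x
  rw [norm_sub_rev x x', ← neg_sub x' x, inner_neg_right] at h2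
  have h3 := (abs_le.1 (abs_real_inner_le_norm (G x' - G x) (x' - x))).1
  have h4 : ‖G x' - G x‖ * ‖x' - x‖ ≤ (L * (1 + C) + ‖B‖ * C) * ‖x' - x‖ * ‖x' - x‖ := by gcongr
  rw [inner_sub_left] at h3
  have h5 : 0 ≤ (L * (1 + C) + ‖B‖ * C) * ‖x' - x‖ ^ 2 := by positivity
  have h6 : 0 ≤ ‖x' - x‖ ^ 2 := by positivity
  rw [abs_le]
  constructor <;> nlinarith

end LinBilevel

/-! ### Call counts and linear convergence of projected gradient -/

theorem Counted.iterate_calls {σ : Type} {step : σ → Counted σ} {k : ℕ}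
    (h : ∀ s, (step s).calls = k) (n : ℕ) (s : σ) :
    (Counted.iterate step n s).calls = k * n := by
  induction n with
  | zero => rfl
  | succ n ih =>
    have e : (Counted.iterate step (n + 1) s).calls
        = (Counted.iterate step n s).calls + (step (Counted.iterate step n s).val).calls := rfl
    rw [e, ih, h, mul_add, mul_one]

theorem one_sub_div_mem {m L : ℝ} (hm : 0 < m) (hmL : m ≤ L) :
    0 ≤ 1 - m ^ 2 / (2 * L ^ 2) ∧ 1 - m ^ 2 / (2 * L ^ 2) < 1 := by
  have hL := hm.trans_le hmL
  refine ⟨?_, by linarith [show 0 < m ^ 2 / (2 * L ^ 2) by positivity]⟩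
  rw [sub_nonneg, div_le_one (by positivity)]
  nlinarith

namespace LinBilevel

variable {dx dy dh : ℕ} {B : Matrix (Fin dh) (Fin dx) ℝ} {A : Matrix (Fin dh) (Fin dy) ℝ}
  {P : LinBilevel B A} {φ : Joint dx dy → ℝ} {L m s : ℝ} {S : Vec dh →ₗ[ℝ] Vec dy}

/-- At primal fixed points `Aᵀ v = -∇g(z)`, so `⟨v - v', A (z - z')⟩ ≤ -m ‖z - z'‖²`, while full row
rank gives `‖v - v'‖ ≤ s L ‖z - z'‖`. Together they give the dual modulus `m / (s L)²`. -/
theorem primalDual_pgd (P : LinBilevel B A) (H : Regular φ L m) (hm : 0 < m) (hmL : m ≤ L)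
    (hs0 : 0 < s) (hS : ∀ w, A.toEuclideanLin (S w) = w) (hs : ∀ w, ‖S w‖ ≤ s * ‖w‖) :
    PrimalDual (1 - m ^ 2 / (2 * L ^ 2)) (m / L ^ 2 * (L + ‖A‖) + ‖A‖ + ‖B‖) (m / (s * L) ^ 2)
      (fun x z v => z - (m / L ^ 2) • ((gradient φ (pair x z)).snd + Aᵀ.toEuclideanLin v))
      P.h projNonneg := by
  have hL := hm.trans_le hmL
  refine ⟨fun x x' z z' v v' => ?_, fun x x' z z' => ?_, fun x z z' v v' h h' => ?_,
    projNonneg_firm⟩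
  · have h1 := norm_sub_smul_sub_le hm hmL (H.monotone x z z')
      (by simpa using H.norm_snd_sub_le hL.le x x z z')
    have e : z - (m / L ^ 2) • ((gradient φ (pair x z)).snd + Aᵀ.toEuclideanLin v)
        - (z' - (m / L ^ 2) • ((gradient φ (pair x' z')).snd + Aᵀ.toEuclideanLin v'))
        = (z - (m / L ^ 2) • (gradient φ (pair x z)).snd
          - (z' - (m / L ^ 2) • (gradient φ (pair x z')).snd))
          - (m / L ^ 2) • (((gradient φ (pair x z')).snd - (gradient φ (pair x' z')).snd)
            + Aᵀ.toEuclideanLin (v - v')) := by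
      rw [map_sub]; module
    rw [e]
    refine (norm_sub_le _ _).trans (add_le_add h1 ?_)
    rw [norm_smul, Real.norm_eq_abs, abs_of_pos (by positivity)]
    have h2 : ‖((gradient φ (pair x z')).snd - (gradient φ (pair x' z')).snd)
            + Aᵀ.toEuclideanLin (v - v')‖ ≤ (L + ‖A‖) * (‖v - v'‖ + ‖x - x'‖) := by
      have h3 := H.norm_snd_sub_le hL.le x x' z' z'
      rw [sub_self, norm_zero, add_zero] at h3
      have h4 := norm_transpose_toEuclideanLin_le A (v - v')
      refine (norm_add_le _ _).trans ?_
      have h5 : 0 ≤ L * ‖v - v'‖ := by positivity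
      have h6 : 0 ≤ ‖A‖ * ‖x - x'‖ := by positivity
      linarith
    calc _ ≤ m / L ^ 2 * ((L + ‖A‖) * (‖v - v'‖ + ‖x - x'‖)) := by gcongr
      _ ≤ (m / L ^ 2 * (L + ‖A‖) + ‖A‖ + ‖B‖) * (‖v - v'‖ + ‖x - x'‖) := by
        rw [← mul_assoc]
        gcongr
        linarith [norm_nonneg A, norm_nonneg B]
  · refine (P.norm_h_sub_le x x' z z').trans ?_
    have h1 : 0 ≤ m / L ^ 2 * (L + ‖A‖) := by positivity
    have h2 := norm_nonneg (z - z')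
    have h3 := norm_nonneg (x - x')
    have h4 := norm_nonneg A
    have h5 := norm_nonneg B
    nlinarith [mul_nonneg h1 h2, mul_nonneg h1 h3, mul_nonneg h4 h3, mul_nonneg h5 h2]
  · have hpos : m / L ^ 2 ≠ 0 := by positivity
    have k1 := (smul_eq_zero_iff_right hpos).1 (sub_eq_self.1 h)
    have k2 := (smul_eq_zero_iff_right hpos).1 (sub_eq_self.1 h')
    have e : Aᵀ.toEuclideanLin (v - v')
        = -((gradient φ (pair x z)).snd - (gradient φ (pair x z')).snd) := by
      rw [map_sub, ← neg_eq_of_add_eq_zero_right k1, ← neg_eq_of_add_eq_zero_right k2]; abel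
    have h1 := H.monotone x z z'
    have h2 := norm_le_of_rightInverse hS hs (v - v')
    rw [h_sub, sub_self, map_zero, zero_add, ← inner_transpose_toEuclideanLin, e, inner_neg_left,
      neg_le_neg_iff]
    rw [e, norm_neg] at h2
    have h3 := H.norm_snd_sub_le hL.le x x z z'
    rw [sub_self, norm_zero, zero_add] at h3
    have h4 : ‖v - v'‖ ≤ s * L * ‖z - z'‖ := by
      rw [mul_assoc]; exact h2.trans (by gcongr)
    have h5 : ‖v - v'‖ ^ 2 ≤ (s * L * ‖z - z'‖) ^ 2 := pow_le_pow_left₀ (norm_nonneg _) h4 2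
    calc m / (s * L) ^ 2 * ‖v - v'‖ ^ 2 ≤ m / (s * L) ^ 2 * (s * L * ‖z - z'‖) ^ 2 := by gcongr
      _ = m * ‖z - z'‖ ^ 2 := by field_simp
      _ ≤ _ := h1

/-- Linear convergence of the projected gradient method. -/
theorem exists_pgd_rate (B : Matrix (Fin dh) (Fin dx) ℝ) {A : Matrix (Fin dh) (Fin dy) ℝ}
    (hA : A.rank = dh) (hm : 0 < m) (hmL : m ≤ L) :
    ∃ τz τv c : ℝ, 0 < τz ∧ 0 < τv ∧ 0 < c ∧ c < 1 ∧ ∀ P : LinBilevel B A, Regular P.g L m →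
      ∀ x, ∃ y u, P.KKT P.g x y u ∧ ∀ s₀ : PGDState dy dh, ∃ E : ℝ, 0 ≤ E ∧ ∀ n,
        ‖(P.pgd τz τv x (n + 1) s₀).val.z - y‖ ^ 2 ≤ E * (1 - c) ^ n ∧
        ‖(P.pgd τz τv x (n + 1) s₀).val.v - u‖ ^ 2 ≤ E * (1 - c) ^ n := by
  obtain ⟨S, s, hs0, hS, hs⟩ := exists_rightInverse_of_rank_eq hA
  have hL := hm.trans_le hmL
  obtain ⟨hq0, hq1⟩ := one_sub_div_mem hm hmL
  obtain ⟨τ, c, C, hτ, hc0, hc1, hC, hmain⟩ := exists_primalDual_rate (X := Vec dx) (Y := Vec dy)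
    (U := Vec dh) hq0 hq1 (L := m / L ^ 2 * (L + ‖A‖) + ‖A‖ + ‖B‖) (κ := m / (s * L) ^ 2)
    (by positivity) (by positivity)
  refine ⟨m / L ^ 2, τ, c, by positivity, hτ, hc0, hc1, fun P H x => ?_⟩
  obtain ⟨ys, us, W, hys, hus, -, -, hW1, -, hW3⟩ := hmain _ _ _ (primalDual_pgd P H hm hmL hs0 hS hs)
  have hpos : m / L ^ 2 ≠ 0 := by positivity
  refine ⟨ys x, us x, ⟨(smul_eq_zero_iff_right hpos).1 (sub_eq_self.1 (hys x)), fun i => ?_⟩,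
    fun s₀ => ?_⟩
  · obtain ⟨h1, h2, h3⟩ := projNonneg_fixed hτ (hus x) i
    exact ⟨h2, h1, h3⟩
  set σ : ℕ → PGDState dy dh := fun n => (P.pgd (m / L ^ 2) τ x n s₀).val with hσ
  have hW0 : ∀ x y u, 0 ≤ W x y u := fun x y u =>
    nonneg_of_mul_nonneg_right (le_trans (by positivity) (hW1 x y u)) hC
  -- PGD moves `z` before `v`, the abstract scheme the dual variable first. Pairing `z` of step `n +
  -- 1` with `v` of step `n` reconciles the two orders and explains the index `n + 1` in the
  -- statement.
  have hstep : ∀ n, W x (σ (n + 2)).z (σ (n + 1)).v ≤ (1 - c) * W x (σ (n + 1)).z (σ n).v := by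
    intro n
    have h := hW3 x x (σ (n + 1)).z (σ n).v
    rw [sub_self, norm_zero, zero_pow two_ne_zero, mul_zero, add_zero] at h
    exact h
  have hc' : 0 ≤ 1 - c := by linarith
  have hpow : ∀ n, W x (σ (n + 1)).z (σ n).v ≤ W x (σ 1).z (σ 0).v * (1 - c) ^ n := by
    intro n
    induction n with
    | zero => simp
    | succ n ih =>
      refine (hstep n).trans ?_
      rw [pow_succ, ← mul_assoc, mul_comm]
      gcongr
  refine ⟨C * W x (σ 1).z (σ 0).v, mul_nonneg hC.le (hW0 _ _ _), fun n => ?_⟩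
  have h1 := mul_le_mul_of_nonneg_left (hpow n) hC.le
  have h2 := mul_le_mul_of_nonneg_left (hstep n) hC.le
  have h3 := hW1 x (σ (n + 1)).z (σ n).v
  have h4 := hW1 x (σ (n + 2)).z (σ (n + 1)).v
  have h5 : (1 - c) * W x (σ (n + 1)).z (σ n).v ≤ 1 * W x (σ (n + 1)).z (σ n).v := by
    gcongr
    · exact hW0 _ _ _
    · linarith
  have h6 := mul_le_mul_of_nonneg_left h5 hC.le
  change ‖(σ (n + 1)).z - ys x‖ ^ 2 ≤ _ ∧ ‖(σ (n + 1)).v - us x‖ ^ 2 ≤ _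
  constructor
  · linarith [sq_nonneg ‖(σ n).v - us x‖]
  · linarith [sq_nonneg ‖(σ (n + 2)).z - ys x‖]

/-! ### One block of SFLCB: the augmented Lagrangian with slack -/

/-- The gradient in `(y, α)` of the augmented Lagrangian of `min φ (x, y)` subject to
`h (x, y) = α`. -/
noncomputable def augGrad (P : LinBilevel B A) (φ : Joint dx dy → ℝ) (ρ : ℝ) (x : Vec dx)
    (p : Joint dy dh) (u : Vec dh) : Joint dy dh :=
  pair ((gradient φ (pair x p.fst)).snd + Aᵀ.toEuclideanLin (u + ρ • (P.h x p.fst - p.snd)))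
    (-(u + ρ • (P.h x p.fst - p.snd)))

/-- The projected gradient step on `(y, α)`. -/
noncomputable def augStep (P : LinBilevel B A) (φ : Joint dx dy → ℝ) (ρ η : ℝ) (x : Vec dx)
    (p : Joint dy dh) (u : Vec dh) : Joint dy dh :=
  pair (p - η • P.augGrad φ ρ x p u).fst (projNonpos (p - η • P.augGrad φ ρ x p u).snd)

theorem norm_augResidual_sub_le (P : LinBilevel B A) (x x' : Vec dx) (p p' : Joint dy dh) :
    ‖(P.h x p.fst - p.snd) - (P.h x' p'.fst - p'.snd)‖
      ≤ ‖B‖ * ‖x - x'‖ + (‖A‖ + 1) * ‖p - p'‖ := by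
  have e : (P.h x p.fst - p.snd) - (P.h x' p'.fst - p'.snd)
      = (P.h x p.fst - P.h x' p'.fst) - (p.snd - p'.snd) := by abel
  rw [e]
  refine (norm_sub_le _ _).trans ?_
  have h1 := P.norm_h_sub_le x x' p.fst p'.fst
  have h2 : ‖p.fst - p'.fst‖ ≤ ‖p - p'‖ := WithLp.norm_fst_le_norm (p - p')
  have h3 : ‖p.snd - p'.snd‖ ≤ ‖p - p'‖ := WithLp.norm_snd_le_norm (p - p')
  have h4 : ‖A‖ * ‖p.fst - p'.fst‖ ≤ ‖A‖ * ‖p - p'‖ := by gcongr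
  linarith

theorem norm_augGrad_sub_le (P : LinBilevel B A) (H : Regular φ L m) (hL : 0 ≤ L) {ρ : ℝ}
    (hρ : 0 ≤ ρ) (x x' : Vec dx) (p p' : Joint dy dh) (u u' : Vec dh) :
    ‖P.augGrad φ ρ x p u - P.augGrad φ ρ x' p' u'‖
      ≤ (L + (‖A‖ + 1) * (1 + ρ * (‖B‖ + ‖A‖ + 1)))
        * (‖p - p'‖ + (‖u - u'‖ + ‖x - x'‖)) := by
  set r := P.h x p.fst - p.snd with hr
  set r' := P.h x' p'.fst - p'.snd with hr'
  have hπ : ‖(u + ρ • r) - (u' + ρ • r')‖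
      ≤ (1 + ρ * (‖B‖ + ‖A‖ + 1)) * (‖p - p'‖ + (‖u - u'‖ + ‖x - x'‖)) := by
    have e : (u + ρ • r) - (u' + ρ • r') = (u - u') + ρ • (r - r') := by module
    have h2 : ‖r - r'‖ ≤ (‖B‖ + ‖A‖ + 1) * (‖p - p'‖ + (‖u - u'‖ + ‖x - x'‖)) := by
      refine (P.norm_augResidual_sub_le x x' p p').trans ?_
      have : 0 ≤ ‖B‖ * ‖p - p'‖ + (‖A‖ + 1) * ‖x - x'‖ + (‖B‖ + ‖A‖ + 1) * ‖u - u'‖ := by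
        positivity
      linarith
    rw [e]
    refine (norm_add_le _ _).trans ?_
    rw [norm_smul, Real.norm_eq_abs, abs_of_nonneg hρ]
    have h3 := mul_le_mul_of_nonneg_left h2 hρ
    linarith [norm_nonneg (p - p'), norm_nonneg (x - x')]
  have e : P.augGrad φ ρ x p u - P.augGrad φ ρ x' p' u'
      = pair (((gradient φ (pair x p.fst)).snd - (gradient φ (pair x' p'.fst)).snd)
        + Aᵀ.toEuclideanLin ((u + ρ • r) - (u' + ρ • r'))) (-((u + ρ • r) - (u' + ρ • r'))) := by
    rw [augGrad, augGrad, pair_sub, ← hr, ← hr', map_sub]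
    congr 1 <;> abel
  rw [e]
  refine (norm_pair_le _ _).trans ?_
  rw [norm_neg]
  have h1 := norm_add_le ((gradient φ (pair x p.fst)).snd - (gradient φ (pair x' p'.fst)).snd)
    (Aᵀ.toEuclideanLin ((u + ρ • r) - (u' + ρ • r')))
  have h2 := norm_transpose_toEuclideanLin_le A ((u + ρ • r) - (u' + ρ • r'))
  have h3 := H.norm_snd_sub_le hL x x' p.fst p'.fst
  have h4 : ‖p.fst - p'.fst‖ ≤ ‖p - p'‖ := WithLp.norm_fst_le_norm (p - p')
  have h5 : L * (‖x - x'‖ + ‖p.fst - p'.fst‖) ≤ L * (‖p - p'‖ + (‖u - u'‖ + ‖x - x'‖)) :=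
    mul_le_mul_of_nonneg_left (by linarith [norm_nonneg (u - u')]) hL
  have h6 := mul_le_mul_of_nonneg_left hπ (show 0 ≤ ‖A‖ + 1 by positivity)
  linarith

/-- The pairing equals that of the `φ`-gradients plus `ρ ‖r - r'‖²`. As the slack difference is `A
(y - y')` minus `r - r'`, these two terms also control the slack. -/
theorem augGrad_monotone (P : LinBilevel B A) (H : Regular φ L m) {ρ m' : ℝ} (hm' : 0 ≤ m')
    (hm1 : m' * (1 + 2 * ‖A‖ ^ 2) ≤ m) (hm2 : 2 * m' ≤ ρ) (x : Vec dx) (p p' : Joint dy dh)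
    (u : Vec dh) :
    m' * ‖p - p'‖ ^ 2 ≤ inner ℝ (P.augGrad φ ρ x p u - P.augGrad φ ρ x p' u) (p - p') := by
  set r := P.h x p.fst - p.snd with hr
  set r' := P.h x p'.fst - p'.snd with hr'
  have hrr : r - r' = A.toEuclideanLin (p.fst - p'.fst) - (p.snd - p'.snd) := by
    have := P.h_sub x x p.fst p'.fst
    rw [sub_self, map_zero, zero_add] at this
    rw [← this, hr, hr']; abel
  have e : inner ℝ (P.augGrad φ ρ x p u - P.augGrad φ ρ x p' u) (p - p')
      = inner ℝ ((gradient φ (pair x p.fst)).snd - (gradient φ (pair x p'.fst)).snd)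
          (p.fst - p'.fst) + ρ * ‖r - r'‖ ^ 2 := by
    have e1 : P.augGrad φ ρ x p u - P.augGrad φ ρ x p' u
      = pair (((gradient φ (pair x p.fst)).snd - (gradient φ (pair x p'.fst)).snd)
        + Aᵀ.toEuclideanLin (ρ • (r - r'))) (-(ρ • (r - r'))) := by
      have e0 : ρ • (r - r') = (u + ρ • r) - (u + ρ • r') := by module
      rw [augGrad, augGrad, pair_sub, ← hr, ← hr', e0, map_sub]
      congr 1 <;> module
    have e2 : p - p' = pair (p.fst - p'.fst) (p.snd - p'.snd) := rfl
    rw [e1, e2, inner_pair]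
    change inner ℝ (_ + _) _ + inner ℝ (-_) _ = _
    rw [inner_add_left, inner_transpose_toEuclideanLin, inner_neg_left, add_assoc,
      ← sub_eq_add_neg, ← inner_sub_right, ← hrr, real_inner_smul_left, real_inner_self_eq_norm_sq]
  have h1 := H.monotone x p.fst p'.fst
  have h2 : ‖p - p'‖ ^ 2 = ‖p.fst - p'.fst‖ ^ 2 + ‖p.snd - p'.snd‖ ^ 2 :=
    WithLp.prod_norm_sq_eq_of_L2 (p - p')
  have h3 : ‖p.snd - p'.snd‖ ≤ ‖A‖ * ‖p.fst - p'.fst‖ + ‖r - r'‖ := by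
    have e3 : p.snd - p'.snd = A.toEuclideanLin (p.fst - p'.fst) - (r - r') := by rw [hrr]; abel
    rw [e3]
    exact (norm_sub_le _ _).trans (by gcongr; exact norm_toEuclideanLin_le _ _)
  have h4 : ‖p.snd - p'.snd‖ ^ 2 ≤ 2 * ‖A‖ ^ 2 * ‖p.fst - p'.fst‖ ^ 2 + 2 * ‖r - r'‖ ^ 2 := by
    have := pow_le_pow_left₀ (norm_nonneg _) h3 2
    nlinarith [sq_nonneg (‖A‖ * ‖p.fst - p'.fst‖ - ‖r - r'‖)]
  have h5 := mul_le_mul_of_nonneg_left h4 hm'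
  have h6 := mul_le_mul_of_nonneg_right hm1 (sq_nonneg ‖p.fst - p'.fst‖)
  have h7 := mul_le_mul_of_nonneg_right hm2 (sq_nonneg ‖r - r'‖)
  rw [e, h2]
  linarith

theorem augStep_fixed {ρ η : ℝ} (hη : 0 < η) {x : Vec dx} {p : Joint dy dh} {u : Vec dh}
    (h : P.augStep φ ρ η x p u = p) :
    (gradient φ (pair x p.fst)).snd + Aᵀ.toEuclideanLin (u + ρ • (P.h x p.fst - p.snd)) = 0 ∧
    ∀ i, p.snd i ≤ 0 ∧ 0 ≤ (u + ρ • (P.h x p.fst - p.snd)) i ∧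
      (u + ρ • (P.h x p.fst - p.snd)) i * p.snd i = 0 := by
  have h1 : p.fst - η • ((gradient φ (pair x p.fst)).snd
      + Aᵀ.toEuclideanLin (u + ρ • (P.h x p.fst - p.snd))) = p.fst := congrArg WithLp.fst h
  have h2 : projNonpos (p.snd - η • (-(u + ρ • (P.h x p.fst - p.snd)))) = p.snd :=
    congrArg WithLp.snd h
  rw [smul_neg, sub_neg_eq_add] at h2
  exact ⟨(smul_eq_zero_iff_right hη.ne').1 (sub_eq_self.1 h1), projNonpos_fixed hη h2⟩

/-- At a primal fixed point the effective multiplier `π = u + ρ r` is stationary and complementary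
to the slack, so `⟨π - π', r - r'⟩ ≤ -m ‖y - y'‖²`. Writing `u - u' = (π - π') - ρ (r - r')` adds
`-ρ ‖r - r'‖²`, and the two negative terms dominate `‖u - u'‖²`. The dual projection is `id` because
the sign of the multiplier is enforced through the slack. -/
theorem primalDual_aug (P : LinBilevel B A) (H : Regular φ L m) (hm : 0 < m) (hmL : m ≤ L)
    (hs0 : 0 < s) (hS : ∀ w, A.toEuclideanLin (S w) = w) (hs : ∀ w, ‖S w‖ ≤ s * ‖w‖)
    {ρ m' L' : ℝ} (hρ : 0 < ρ) (hm' : 0 < m') (hm1 : m' * (1 + 2 * ‖A‖ ^ 2) ≤ m)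
    (hm2 : 2 * m' ≤ ρ) (hmL' : m' ≤ L')
    (hL' : L' = L + (‖A‖ + 1) * (1 + ρ * (‖B‖ + ‖A‖ + 1))) :
    PrimalDual (1 - m' ^ 2 / (2 * L' ^ 2)) (m' / L' ^ 2 * L' + (‖A‖ + 1) + ‖B‖)
      (1 / (2 * (s * L) ^ 2 / m + 2 * ρ)) (P.augStep φ ρ (m' / L' ^ 2))
      (fun x p => P.h x p.fst - p.snd) id := by
  have hL := hm.trans_le hmL
  have hL0 := hm'.trans_le hmL'
  have hη : 0 < m' / L' ^ 2 := by positivity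
  refine ⟨fun x x' p p' u u' => ?_, fun x x' p p' => ?_, fun x p p' u u' h h' => ?_,
    fun a b => by simp⟩
  · have hproj : ∀ a b : Joint dy dh,
        ‖pair a.fst (projNonpos a.snd) - pair b.fst (projNonpos b.snd)‖ ≤ ‖a - b‖ := by
      intro a b
      refine le_of_sq_le_sq ?_ (norm_nonneg _)
      rw [pair_sub, norm_pair_sq, WithLp.prod_norm_sq_eq_of_L2]
      gcongr
      · exact le_rfl
      · exact norm_projNonpos_sub_le _ _
    refine (hproj _ _).trans ?_
    have h1 := P.norm_augGrad_sub_le H hL.le hρ.le x x p p' u u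
    have h2 := P.norm_augGrad_sub_le H hL.le hρ.le x x' p' p' u u'
    rw [← hL'] at h1 h2
    simp only [sub_self, norm_zero, add_zero, zero_add] at h1 h2
    have h3 := norm_sub_smul_sub_le hm' hmL' (P.augGrad_monotone H hm'.le hm1 hm2 x p p' u) h1
    refine (norm_sub_le_norm_sub_add_norm_sub _
      (p' - (m' / L' ^ 2) • P.augGrad φ ρ x p' u) _).trans (add_le_add h3 ?_)
    rw [sub_sub_sub_cancel_left, ← smul_sub, norm_smul, Real.norm_eq_abs, abs_of_pos hη,
      norm_sub_rev]
    calc _ ≤ m' / L' ^ 2 * (L' * (‖u - u'‖ + ‖x - x'‖)) := by gcongr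
      _ ≤ _ := by
        rw [← mul_assoc]
        gcongr
        linarith [norm_nonneg A, norm_nonneg B]
  · refine (P.norm_augResidual_sub_le x x' p p').trans ?_
    have : 0 ≤ m' / L' ^ 2 * L' * (‖p - p'‖ + ‖x - x'‖) + (‖A‖ + 1) * ‖x - x'‖
        + ‖B‖ * ‖p - p'‖ := by positivity
    linarith
  · obtain ⟨k1, k2⟩ := augStep_fixed hη h
    obtain ⟨k1', k2'⟩ := augStep_fixed hη h'
    set r := P.h x p.fst - p.snd with hr
    set r' := P.h x p'.fst - p'.snd with hr'
    have hrr : r - r' = A.toEuclideanLin (p.fst - p'.fst) - (p.snd - p'.snd) := by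
      have := P.h_sub x x p.fst p'.fst
      rw [sub_self, map_zero, zero_add] at this
      rw [← this, hr, hr']; abel
    have h1 := inner_sub_nonneg_of_complementary k2 k2'
    have h2 := H.monotone x p.fst p'.fst
    set π := u + ρ • r with hπ
    set π' := u' + ρ • r' with hπ'
    have e : Aᵀ.toEuclideanLin (π - π')
        = -((gradient φ (pair x p.fst)).snd - (gradient φ (pair x p'.fst)).snd) := by
      rw [map_sub, ← neg_eq_of_add_eq_zero_right k1, ← neg_eq_of_add_eq_zero_right k1']; abel
    have eu : u - u' = (π - π') - ρ • (r - r') := by rw [hπ, hπ']; module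
    have h3 : inner ℝ (π - π') (r - r') ≤ -(m * ‖p.fst - p'.fst‖ ^ 2) := by
      rw [hrr, inner_sub_right, ← inner_transpose_toEuclideanLin, e, inner_neg_left]
      linarith
    have h4 : ‖π - π'‖ ≤ s * L * ‖p.fst - p'.fst‖ := by
      have h5 := norm_le_of_rightInverse hS hs (π - π')
      rw [e, norm_neg] at h5
      have h6 := H.norm_snd_sub_le hL.le x x p.fst p'.fst
      rw [sub_self, norm_zero, zero_add] at h6
      rw [mul_assoc]
      exact h5.trans (by gcongr)
    have h5 : ‖u - u'‖ ≤ s * L * ‖p.fst - p'.fst‖ + ρ * ‖r - r'‖ := by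
      rw [eu]
      refine (norm_sub_le _ _).trans (add_le_add h4 ?_)
      rw [norm_smul, Real.norm_eq_abs, abs_of_pos hρ]
    have h6 : ‖u - u'‖ ^ 2
        ≤ 2 * (s * L) ^ 2 * ‖p.fst - p'.fst‖ ^ 2 + 2 * ρ ^ 2 * ‖r - r'‖ ^ 2 := by
      have := pow_le_pow_left₀ (norm_nonneg _) h5 2
      nlinarith [sq_nonneg (s * L * ‖p.fst - p'.fst‖ - ρ * ‖r - r'‖)]
    have h7 : inner ℝ (u - u') (r - r')
        ≤ -(m * ‖p.fst - p'.fst‖ ^ 2) - ρ * ‖r - r'‖ ^ 2 := by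
      rw [eu, inner_sub_left, real_inner_smul_left, real_inner_self_eq_norm_sq]
      linarith
    refine h7.trans ?_
    rw [← neg_add', neg_le_neg_iff, div_mul_eq_mul_div, one_mul, div_le_iff₀ (by positivity)]
    have e8 : (m * ‖p.fst - p'.fst‖ ^ 2 + ρ * ‖r - r'‖ ^ 2) * (2 * (s * L) ^ 2 / m + 2 * ρ)
        = 2 * (s * L) ^ 2 * ‖p.fst - p'.fst‖ ^ 2 + 2 * ρ ^ 2 * ‖r - r'‖ ^ 2
          + (2 * ρ * m * ‖p.fst - p'.fst‖ ^ 2 + ρ * ‖r - r'‖ ^ 2 * (2 * (s * L) ^ 2 / m)) := by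
      field_simp; ring
    have h9 : 0 ≤ 2 * ρ * m * ‖p.fst - p'.fst‖ ^ 2
        + ρ * ‖r - r'‖ ^ 2 * (2 * (s * L) ^ 2 / m) := by positivity
    linarith

/-- A Lyapunov function for one primal-dual block of the single-loop method. -/
theorem exists_aug_rate (B : Matrix (Fin dh) (Fin dx) ℝ) {A : Matrix (Fin dh) (Fin dy) ℝ}
    (hA : A.rank = dh) (hm : 0 < m) (hmL : m ≤ L) {ρ : ℝ} (hρ : 0 < ρ) :
    ∃ η τ c C : ℝ, 0 < η ∧ 0 < τ ∧ 0 < c ∧ c < 1 ∧ 0 < C ∧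
      ∀ (P : LinBilevel B A) (φ : Joint dx dy → ℝ), Regular φ L m →
      ∃ (ys : Vec dx → Vec dy) (us : Vec dx → Vec dh) (W : Vec dx → Joint dy dh → Vec dh → ℝ),
        (∀ x, P.KKT φ x (ys x) (us x)) ∧
        (∀ x x', ‖ys x - ys x'‖ ≤ C * ‖x - x'‖) ∧ (∀ x x', ‖us x - us x'‖ ≤ C * ‖x - x'‖) ∧
        (∀ x p u, ‖p - pair (ys x) (P.h x (ys x))‖ ^ 2 + ‖u - us x‖ ^ 2 ≤ C * W x p u) ∧
        (∀ x p u, W x p u ≤ C * (‖p - pair (ys x) (P.h x (ys x))‖ ^ 2 + ‖u - us x‖ ^ 2)) ∧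
        (∀ x x' p u, W x' (P.augStep φ ρ η x p (u + τ • (P.h x p.fst - p.snd)))
          (u + τ • (P.h x p.fst - p.snd)) ≤ (1 - c) * W x p u + C * ‖x - x'‖ ^ 2) := by
  obtain ⟨S, s, hs0, hS, hs⟩ := exists_rightInverse_of_rank_eq hA
  have hL := hm.trans_le hmL
  obtain ⟨m', hm', hm1, hm2⟩ : ∃ m' : ℝ, 0 < m' ∧ m' * (1 + 2 * ‖A‖ ^ 2) ≤ m ∧ 2 * m' ≤ ρ := by
    refine ⟨min (m / (1 + 2 * ‖A‖ ^ 2)) (ρ / 2), by positivity, ?_, ?_⟩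
    · rw [← le_div_iff₀ (by positivity)]
      exact min_le_left _ _
    · linarith [min_le_right (m / (1 + 2 * ‖A‖ ^ 2)) (ρ / 2)]
  obtain ⟨L', hL'⟩ : ∃ L', L' = L + (‖A‖ + 1) * (1 + ρ * (‖B‖ + ‖A‖ + 1)) := ⟨_, rfl⟩
  have hmL' : m' ≤ L' := by
    have : m' * 1 ≤ m' * (1 + 2 * ‖A‖ ^ 2) := by
      gcongr
      linarith [sq_nonneg ‖A‖]
    have h2 : 0 ≤ (‖A‖ + 1) * (1 + ρ * (‖B‖ + ‖A‖ + 1)) := by positivity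
    linarith
  have hL0 := hm'.trans_le hmL'
  obtain ⟨hq0, hq1⟩ := one_sub_div_mem hm' hmL'
  obtain ⟨τ, c, C, hτ, hc0, hc1, hC, hmain⟩ := exists_primalDual_rate (X := Vec dx)
    (Y := Joint dy dh) (U := Vec dh) hq0 hq1 (L := m' / L' ^ 2 * L' + (‖A‖ + 1) + ‖B‖)
    (κ := 1 / (2 * (s * L) ^ 2 / m + 2 * ρ)) (by positivity) (by positivity)
  have hη : 0 < m' / L' ^ 2 := by positivity
  refine ⟨m' / L' ^ 2, τ, c, C, hη, hτ, hc0, hc1, hC, fun P φ H => ?_⟩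
  obtain ⟨ps, us, W, hps, hus, hpL, huL, hW1, hW2, hW3⟩ :=
    hmain _ _ _ (primalDual_aug P H hm hmL hs0 hS hs hρ hm' hm1 hm2 hmL' hL')
  -- With `D = id` a dual fixed point has zero residual, so the slack equals `h (x, y)` and its
  -- complementarity becomes the KKT condition.
  have hr : ∀ x, P.h x (ps x).fst - (ps x).snd = 0 := fun x =>
    (smul_eq_zero_iff_right hτ.ne').1 (add_eq_left.1 (hus x))
  have hps' : ∀ x, pair (ps x).fst (P.h x (ps x).fst) = ps x := fun x => by
    rw [sub_eq_zero.1 (hr x)]; rfl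
  refine ⟨fun x => (ps x).fst, us, W, fun x => ?_, fun x x' => ?_, huL, fun x p u => ?_,
    fun x p u => ?_, hW3⟩
  · obtain ⟨h1, h2⟩ := augStep_fixed hη (hps x)
    rw [hr, smul_zero, add_zero] at h1 h2
    refine ⟨h1, ?_⟩
    rwa [sub_eq_zero.1 (hr x)]
  · exact (WithLp.norm_fst_le_norm (ps x - ps x')).trans (hpL x x')
  · rw [hps']; exact hW1 x p u
  · rw [hps']; exact hW2 x p u

end LinBilevel

/-! ### Coupling the blocks: descent of the potential -/

theorem hasGradientAt_of_abs_sub_le {H : Type*} [NormedAddCommGroup H] [InnerProductSpace ℝ H]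
    [CompleteSpace H] {F : H → ℝ} {x D : H} {E : ℝ}
    (h : ∀ x', |F x' - F x - inner ℝ D (x' - x)| ≤ E * ‖x' - x‖ ^ 2) : HasGradientAt F D x := by
  rw [hasGradientAt_iff_isLittleO]
  refine Asymptotics.IsBigO.trans_isLittleO (g := fun x' => ‖x' - x‖ ^ 2) ?_
    (Asymptotics.isLittleO_pow_sub_sub x one_lt_two)
  refine Asymptotics.IsBigO.of_bound E (.of_forall fun x' => ?_)
  rw [Real.norm_eq_abs, Real.norm_eq_abs, abs_of_nonneg (by positivity : 0 ≤ ‖x' - x‖ ^ 2)]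
  exact h x'

namespace LinBilevel

variable {dx dy dh : ℕ} {B : Matrix (Fin dh) (Fin dx) ℝ} {A : Matrix (Fin dh) (Fin dy) ℝ}
  {P : LinBilevel B A} {φ φ₀ : Joint dx dy → ℝ} {L m s : ℝ} {S : Vec dh →ₗ[ℝ] Vec dy}

/-- The gradient in `x` of the optimal value of a block, expressed through a KKT pair. -/
noncomputable def valueGrad (B : Matrix (Fin dh) (Fin dx) ℝ) (φ : Joint dx dy → ℝ) (x : Vec dx)
    (y : Vec dy) (u : Vec dh) : Vec dx :=
  (gradient φ (pair x y)).fst + Bᵀ.toEuclideanLin u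

/-- Bounds the error of one block in the `x`-direction. The residual vanishes at `(y, h (x, y))`, so
the extra term `k • r` is itself of the order of the primal error; `k = τ + ρ` will account for the
multiplier update and the penalty together. -/
theorem norm_valueGrad_sub_le (H : Regular φ L m) (hL : 0 ≤ L) {k : ℝ} (hk : 0 ≤ k) (x : Vec dx)
    (y : Vec dy) (p : Joint dy dh) (u u' : Vec dh) :
    ‖valueGrad B φ x p.fst (u + k • (P.h x p.fst - p.snd)) - valueGrad B φ x y u'‖
      ≤ (L + ‖B‖ * (1 + k * (‖A‖ + 1))) * (‖p - pair y (P.h x y)‖ + ‖u - u'‖) := by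
  set r := P.h x p.fst - p.snd with hr
  have h1 : ‖r‖ ≤ (‖A‖ + 1) * ‖p - pair y (P.h x y)‖ := by
    have h := P.norm_augResidual_sub_le x x p (pair y (P.h x y))
    have e : P.h x (pair y (P.h x y)).fst - (pair y (P.h x y)).snd = 0 := sub_self _
    rwa [e, sub_zero, sub_self, norm_zero, mul_zero, zero_add] at h
  have h2 : ‖p.fst - y‖ ≤ ‖p - pair y (P.h x y)‖ :=
    WithLp.norm_fst_le_norm (p - pair y (P.h x y))
  have h3 := H.norm_fst_sub_le hL x x p.fst y
  rw [sub_self, norm_zero, zero_add] at h3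
  have h4 : ‖Bᵀ.toEuclideanLin ((u + k • r) - u')‖ ≤ ‖B‖ * (‖u - u'‖ + k * ‖r‖) := by
    refine (norm_transpose_toEuclideanLin_le B _).trans ?_
    gcongr
    have e : (u + k • r) - u' = (u - u') + k • r := by abel
    rw [e]
    refine (norm_add_le _ _).trans ?_
    rw [norm_smul, Real.norm_eq_abs, abs_of_nonneg hk]
  have e : valueGrad B φ x p.fst (u + k • r) - valueGrad B φ x y u'
      = ((gradient φ (pair x p.fst)).fst - (gradient φ (pair x y)).fst)
        + Bᵀ.toEuclideanLin ((u + k • r) - u') := by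
    simp only [valueGrad, map_sub]; abel
  rw [e]
  refine (norm_add_le _ _).trans ?_
  have h5 := mul_le_mul_of_nonneg_left h2 hL
  have h6 : ‖B‖ * (‖u - u'‖ + k * ‖r‖)
      ≤ ‖B‖ * (‖u - u'‖ + k * ((‖A‖ + 1) * ‖p - pair y (P.h x y)‖)) := by gcongr
  have h7 : 0 ≤ L * ‖u - u'‖ + ‖B‖ * ‖p - pair y (P.h x y)‖
      + ‖B‖ * (k * (‖A‖ + 1)) * ‖u - u'‖ := by positivity
  linarith

/-- The error of a block started at an approximate KKT pair of a nearby problem. -/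
theorem KKT.norm_start_sub_le {x : Vec dx} {y y₀ z : Vec dy} {u u₀ v : Vec dh} {d N : ℝ}
    (K : P.KKT φ x y u) (K₀ : P.KKT φ₀ x y₀ u₀) (H : Regular φ L m) (hm : 0 < m) (hL : 0 ≤ L)
    (hs0 : 0 < s) (hS : ∀ w, A.toEuclideanLin (S w) = w) (hs : ∀ w, ‖S w‖ ≤ s * ‖w‖)
    (hN : ‖(gradient φ (pair x y₀)).snd - (gradient φ₀ (pair x y₀)).snd‖ ≤ N)
    (hz : ‖z - y₀‖ ≤ d) (hv : ‖v - u₀‖ ≤ d) :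
    ‖pair z (P.h x z) - pair y (P.h x y)‖ ≤ (1 + ‖A‖) * (1 + 1 / m) * (d + N) ∧
    ‖v - u‖ ≤ (1 + s * (L / m + 1)) * (d + N) := by
  have hd : 0 ≤ d := (norm_nonneg _).trans hz
  have hN0 : 0 ≤ N := (norm_nonneg _).trans hN
  have h1 : ‖y - y₀‖ ≤ N / m := by
    rw [le_div_iff₀' hm]; exact (K.norm_sub_le K₀ H).trans hN
  have h2 : ‖u - u₀‖ ≤ s * (L * (N / m) + N) :=
    (K.norm_multiplier_sub_le K₀ H hL hs0.le hS hs).trans (by gcongr)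
  have h3 : ‖z - y‖ ≤ (1 + 1 / m) * (d + N) := by
    have h4 := norm_sub_le_norm_sub_add_norm_sub z y₀ y
    rw [norm_sub_rev y₀ y] at h4
    have h5 : (1 + 1 / m) * (d + N) = d + N / m + (N + d / m) := by ring
    have h6 : 0 ≤ N + d / m := by positivity
    linarith
  constructor
  · rw [pair_sub]
    refine (norm_pair_le _ _).trans ?_
    have h4 := P.norm_h_sub_le x x z y
    rw [sub_self, norm_zero, mul_zero, zero_add] at h4
    calc _ ≤ (1 + ‖A‖) * ‖z - y‖ := by linarith
      _ ≤ _ := by rw [mul_assoc]; gcongr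
  · have h4 := norm_sub_le_norm_sub_add_norm_sub v u₀ u
    rw [norm_sub_rev u₀ u] at h4
    have h5 : (1 + s * (L / m + 1)) * (d + N)
        = d + s * (L * (N / m) + N) + (N + s * (L / m + 1) * d) := by ring
    have h6 : 0 ≤ N + s * (L / m + 1) * d := by positivity
    linarith

/-- Everything that the analysis of the outer iteration needs about one block. -/
theorem exists_block_rate (B : Matrix (Fin dh) (Fin dx) ℝ) {A : Matrix (Fin dh) (Fin dy) ℝ}
    (hA : A.rank = dh) (hm : 0 < m) (hmL : m ≤ L) {ρ : ℝ} (hρ : 0 < ρ) :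
    ∃ η τ c C : ℝ, 0 < η ∧ 0 < τ ∧ 0 < c ∧ c < 1 ∧ 0 < C ∧
      ∀ (P : LinBilevel B A) (φ : Joint dx dy → ℝ), Regular φ L m →
      ∃ (ys : Vec dx → Vec dy) (us : Vec dx → Vec dh) (W : Vec dx → Joint dy dh → Vec dh → ℝ),
        (∀ x, P.KKT φ x (ys x) (us x)) ∧ (∀ x p u, 0 ≤ W x p u) ∧
        (∀ x x' p u, W x' (P.augStep φ ρ η x p (u + τ • (P.h x p.fst - p.snd)))
          (u + τ • (P.h x p.fst - p.snd)) ≤ (1 - c) * W x p u + C * ‖x - x'‖ ^ 2) ∧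
        (∀ x p u, ‖valueGrad B φ x p.fst (u + (τ + ρ) • (P.h x p.fst - p.snd))
          - valueGrad B φ x (ys x) (us x)‖ ^ 2 ≤ C * W x p u) ∧
        (∀ x x', |φ (pair x' (ys x')) - φ (pair x (ys x))
          - inner ℝ (valueGrad B φ x (ys x) (us x)) (x' - x)| ≤ C * ‖x' - x‖ ^ 2) ∧
        (∀ φ₀ x y₀ u₀ z v d N, P.KKT φ₀ x y₀ u₀ →
          ‖(gradient φ (pair x y₀)).snd - (gradient φ₀ (pair x y₀)).snd‖ ≤ N →
          ‖z - y₀‖ ≤ d → ‖v - u₀‖ ≤ d → W x (pair z (P.h x z)) v ≤ C * (d + N) ^ 2) := by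
  obtain ⟨S, s, hs0, hS, hs⟩ := exists_rightInverse_of_rank_eq hA
  have hL := hm.trans_le hmL
  obtain ⟨η, τ, c, C, hη, hτ, hc0, hc1, hC, hmain⟩ := exists_aug_rate B hA hm hmL hρ
  obtain ⟨E, hE, henv⟩ := exists_envelope_bound B hA hL.le hC.le
  obtain ⟨k, hk⟩ : ∃ k, k = L + ‖B‖ * (1 + (τ + ρ) * (‖A‖ + 1)) := ⟨_, rfl⟩
  obtain ⟨a, ha⟩ : ∃ a, a = (1 + ‖A‖) * (1 + 1 / m) := ⟨_, rfl⟩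
  obtain ⟨b, hb⟩ : ∃ b, b = 1 + s * (L / m + 1) := ⟨_, rfl⟩
  have hk0 : 0 < k := by rw [hk]; positivity
  have ha0 : 0 < a := by rw [ha]; positivity
  have hb0 : 0 < b := by rw [hb]; positivity
  refine ⟨η, τ, c, C + E + 2 * k ^ 2 * C + C * (a ^ 2 + b ^ 2), hη, hτ, hc0, hc1, by positivity,
    fun P φ H => ?_⟩
  obtain ⟨ys, us, W, K, hyL, huL, hW1, hW2, hW3⟩ := hmain P φ H
  have hW0 : ∀ x p u, 0 ≤ W x p u := fun x p u =>
    nonneg_of_mul_nonneg_right (le_trans (by positivity) (hW1 x p u)) hC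
  have hCab : 0 ≤ C * (a ^ 2 + b ^ 2) := by positivity
  have hkC : 0 ≤ 2 * k ^ 2 * C := by positivity
  refine ⟨ys, us, W, K, hW0, fun x x' p u => (hW3 x x' p u).trans ?_, fun x p u => ?_,
    fun x x' => (henv P φ m ys us H hm K hyL huL x x').trans ?_,
    fun φ₀ x y₀ u₀ z v d N K₀ hN hz hv => ?_⟩
  · gcongr
    linarith
  · have h1 := norm_valueGrad_sub_le (P := P) H hL.le (add_pos hτ hρ).le x (ys x) p u (us x)
    rw [← hk] at h1
    have h2 := pow_le_pow_left₀ (norm_nonneg _) h1 2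
    have h3 : (k * (‖p - pair (ys x) (P.h x (ys x))‖ + ‖u - us x‖)) ^ 2
        ≤ 2 * k ^ 2 * (‖p - pair (ys x) (P.h x (ys x))‖ ^ 2 + ‖u - us x‖ ^ 2) := by
      rw [mul_pow, mul_comm 2 (k ^ 2), mul_assoc]
      gcongr
      exact add_sq_le
    have h4 := mul_le_mul_of_nonneg_left (hW1 x p u) (show 0 ≤ 2 * k ^ 2 by positivity)
    have h5 : 2 * k ^ 2 * C * W x p u
        ≤ (C + E + 2 * k ^ 2 * C + C * (a ^ 2 + b ^ 2)) * W x p u := by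
      gcongr
      · exact hW0 x p u
      · linarith
    linarith
  · gcongr
    linarith
  · obtain ⟨h1, h2⟩ := (K x).norm_start_sub_le K₀ H hm hL.le hs0 hS hs hN hz hv
    rw [← ha] at h1
    rw [← hb] at h2
    have h3 := pow_le_pow_left₀ (norm_nonneg _) h1 2
    have h4 := pow_le_pow_left₀ (norm_nonneg _) h2 2
    refine (hW2 _ _ _).trans ?_
    calc _ ≤ C * ((a * (d + N)) ^ 2 + (b * (d + N)) ^ 2) := by gcongr
      _ = C * (a ^ 2 + b ^ 2) * (d + N) ^ 2 := by ring
      _ ≤ _ := by gcongr; linarith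

theorem sflcbStep_calls (P : LinBilevel B A) (δ : ℝ) (c : SFLCBParams) (s : SFLCBState dx dy dh) :
    (P.sflcbStep δ c s).calls = 3 := rfl

theorem pgdStep_calls (P : LinBilevel B A) (τz τv : ℝ) (x : Vec dx) (s : PGDState dy dh) :
    (P.pgdStep τz τv x s).calls = 1 := rfl

/-- The step of the single-loop method in terms of its two blocks. -/
theorem sflcbStep_blocks (P : LinBilevel B A) (hf : Differentiable ℝ P.f)
    (hg : Differentiable ℝ P.g) (δ : ℝ) (c : SFLCBParams) (s : SFLCBState dx dy dh) :
    let φ : Joint dx dy → ℝ := fun p => δ * P.f p + P.g p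
    let s' := (P.sflcbStep δ c s).val
    let p := pair s.y s.α
    let q := pair s.z s.β
    let ry := P.h s.x p.fst - p.snd
    let rz := P.h s.x q.fst - q.snd
    s'.u = s.u + c.ηu • ry ∧ s'.v = s.v + c.ηv • rz ∧
    pair s'.y s'.α = P.augStep φ c.ρ₁ c.ηy s.x p s'.u ∧
    pair s'.z s'.β = P.augStep P.g c.ρ₂ c.ηz s.x q s'.v ∧
    s'.x = s.x - c.ηx • (valueGrad B φ s.x p.fst (s.u + (c.ηu + c.ρ₁) • ry)
      - valueGrad B P.g s.x q.fst (s.v + (c.ηv + c.ρ₂) • rz)) := by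
  intro φ s' p q ry rz
  refine ⟨rfl, rfl, ?_, ?_, ?_⟩
  · have e : gradient φ (pair s.x s.y) = _ := gradient_penalised hf hg δ (pair s.x s.y)
    change _ = pair (s.y - c.ηy • ((gradient φ (pair s.x s.y)).snd + _)) _
    rw [e]
    rfl
  · have e1 : s'.z = s.z - c.ηz • ((gradient P.g (pair s.x s.z)).snd
        + Aᵀ.toEuclideanLin (s'.v + c.ρ₂ • rz)) := by
      rw [sub_eq_add_neg, ← smul_neg]; rfl
    have e2 : s'.β = projNonpos (s.β - c.ηz • (-(s'.v + c.ρ₂ • rz))) := by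
      rw [smul_neg, sub_neg_eq_add]; rfl
    rw [e1, e2]
    rfl
  · have e : gradient φ (pair s.x s.y) = _ := gradient_penalised hf hg δ (pair s.x s.y)
    have e1 : s'.x = s.x - c.ηx • (δ • (gradient P.f (pair s.x s.y)).fst
        + (gradient P.g (pair s.x s.y)).fst - (gradient P.g (pair s.x s.z)).fst
        + Bᵀ.toEuclideanLin ((s.u + c.ηu • ry) + c.ρ₁ • ry)
        - Bᵀ.toEuclideanLin ((s.v + c.ηv • rz) + c.ρ₂ • rz)) := rfl
    have e2 : valueGrad B φ s.x p.fst (s.u + (c.ηu + c.ρ₁) • ry)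
        = δ • (gradient P.f (pair s.x s.y)).fst + (gradient P.g (pair s.x s.y)).fst
          + Bᵀ.toEuclideanLin ((s.u + c.ηu • ry) + c.ρ₁ • ry) := by
      change (gradient φ (pair s.x s.y)).fst + _ = _
      rw [e, add_smul, ← add_assoc]
      rfl
    have e3 : valueGrad B P.g s.x q.fst (s.v + (c.ηv + c.ρ₂) • rz)
        = (gradient P.g (pair s.x s.z)).fst
          + Bᵀ.toEuclideanLin ((s.v + c.ηv • rz) + c.ρ₂ • rz) := by
      rw [add_smul, ← add_assoc]
      rfl
    rw [e1, e2, e3]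
    congr 2
    abel

set_option maxHeartbeats 1000000 in
/-- A potential that every iteration of the single-loop method decreases. -/
theorem exists_sflcb_decrease (B : Matrix (Fin dh) (Fin dx) ℝ) {A : Matrix (Fin dh) (Fin dy) ℝ}
    (hA : A.rank = dh) {μg : ℝ} (hμg : 0 < μg) (lf1 lg1 : ℝ≥0) {ρ₁ ρ₂ : ℝ} (hρ₁ : 0 < ρ₁)
    (hρ₂ : 0 < ρ₂) :
    ∃ ηx ηy ηz ηu ηv C : ℝ, 0 < ηx ∧ 0 < ηy ∧ 0 < ηz ∧ 0 < ηu ∧ 0 < ηv ∧ 0 < C ∧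
      ∀ (P : LinBilevel B A) (lf0 : ℝ≥0), P.Assumptions lf0 lf1 lg1 μg →
      ∀ δ : ℝ, 0 < δ → 2 * lf1 * δ ≤ μg →
      ∃ (yδ yg : Vec dx → Vec dy) (uδ ug : Vec dx → Vec dh) (W : SFLCBState dx dy dh → ℝ),
        (∀ x, P.KKT (fun p => δ * P.f p + P.g p) x (yδ x) (uδ x)) ∧
        (∀ x, P.KKT P.g x (yg x) (ug x)) ∧
        Differentiable ℝ (P.Phiδ δ) ∧ (∀ s, 0 ≤ W s) ∧
        (∀ s, let s' := (P.sflcbStep δ ⟨ρ₁, ρ₂, ηx, ηy, ηz, ηu, ηv⟩ s).val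
          δ * P.Phiδ δ s'.x + W s' ≤ δ * P.Phiδ δ s.x + W s
            - ηx / 2 * (δ * ‖gradient (P.Phiδ δ) s.x‖) ^ 2) ∧
        (∀ x y₀ u₀ (s : PGDState dy dh), P.KKT P.g x y₀ u₀ → ‖s.z - y₀‖ ≤ δ → ‖s.v - u₀‖ ≤ δ →
          W (P.warmStart x s) ≤ C * (1 + ‖gradient P.f (pair x y₀)‖) ^ 2 * δ ^ 2) := by
  have hm : 0 < μg / 2 := by positivity
  have hmL : μg / 2 ≤ lg1 + μg / 2 := by linarith [lg1.coe_nonneg]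
  obtain ⟨ηy, ηu, c₁, C₁, hηy, hηu, hc₁, hc₁', hC₁, H₁⟩ := exists_block_rate B hA hm hmL hρ₁
  obtain ⟨ηz, ηv, c₂, C₂, hηz, hηv, hc₂, hc₂', hC₂, H₂⟩ := exists_block_rate B hA hm hmL hρ₂
  obtain ⟨c, hc, hcc₁, hcc₂⟩ : ∃ c : ℝ, 0 < c ∧ c ≤ c₁ ∧ c ≤ c₂ :=
    ⟨min c₁ c₂, lt_min hc₁ hc₂, min_le_left _ _, min_le_right _ _⟩
  obtain ⟨C, hC⟩ : ∃ C, C = C₁ + C₂ := ⟨_, rfl⟩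
  have hC0 : 0 < C := by rw [hC]; positivity
  -- `ηx C ≤ c` lets the contraction of `W` absorb the error of the `x`-direction; `4 ηx C ≤ 1` lets
  -- `-(ηx / 2) ‖G₁ - G₂‖²` absorb the two quadratic terms `C ‖x' - x‖²`, from the envelope bound
  -- and from the drift of `W`.
  obtain ⟨ηx, hηx, hηx1, hηx2⟩ : ∃ ηx : ℝ, 0 < ηx ∧ ηx * C ≤ c ∧ ηx * (4 * C) ≤ 1 := by
    refine ⟨min (c / C) (1 / (4 * C)), by positivity, ?_, ?_⟩
    · rw [← le_div_iff₀ (by positivity)]; exact min_le_left _ _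
    · rw [← le_div_iff₀ (by positivity)]; exact min_le_right _ _
  refine ⟨ηx, ηy, ηz, ηu, ηv, C, hηx, hηy, hηz, hηu, hηv, hC0, fun P lf0 H δ hδ hδ' => ?_⟩
  have hf := H.contDiff_f.differentiable one_ne_zero
  have hg := H.contDiff_g.differentiable one_ne_zero
  have R₁ := H.regular_penalised hδ.le hδ'
  have R₂ := H.regular_g hμg
  set φ : Joint dx dy → ℝ := fun p => δ * P.f p + P.g p with hφ
  obtain ⟨yδ, uδ, W₁, K₁, hW₁, hs₁, hd₁, he₁, hi₁⟩ := H₁ P φ R₁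
  obtain ⟨yg, ug, W₂, K₂, hW₂, hs₂, hd₂, he₂, hi₂⟩ := H₂ P P.g R₂
  set D : Vec dx → Vec dx := fun x =>
    valueGrad B φ x (yδ x) (uδ x) - valueGrad B P.g x (yg x) (ug x) with hD
  have hyδ : ∀ x, P.yStarδ δ x = yδ x := fun x => (K₁ x).argminOn_eq R₁ hm
  have hyg : ∀ x, P.yStar x = yg x := fun x => (K₂ x).argminOn_eq R₂ hm
  -- Multiplication by `δ` exhibits a difference of two value functions, each with its own envelope
  -- bound.
  have hF : ∀ x, δ * P.Phiδ δ x = φ (pair x (yδ x)) - P.g (pair x (yg x)) := by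
    intro x
    simp only [Phiδ, hyδ, hyg, hφ]
    field_simp
    ring
  have henv : ∀ x x', |δ * P.Phiδ δ x' - δ * P.Phiδ δ x - inner ℝ (D x) (x' - x)|
      ≤ C * ‖x' - x‖ ^ 2 := by
    intro x x'
    have h1 := abs_le.1 (he₁ x x')
    have h2 := abs_le.1 (he₂ x x')
    rw [hF, hF, hD, hC]
    simp only [inner_sub_left]
    rw [abs_le]
    constructor <;> linarith
  have hgrad : ∀ x, HasGradientAt (P.Phiδ δ) (δ⁻¹ • D x) x := by
    intro x
    have h := hasGradientAt_of_abs_sub_le (henv x)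
    rw [hasGradientAt_iff_hasFDerivAt] at h ⊢
    refine ((h.const_mul δ⁻¹).congr_of_eventuallyEq (.of_forall fun x => ?_)).congr_fderiv ?_
    · simp [hδ.ne']
    · simp
  refine ⟨yδ, yg, uδ, ug, fun s => W₁ s.x (pair s.y s.α) s.u + W₂ s.x (pair s.z s.β) s.v, K₁, K₂,
    fun x => (hgrad x).differentiableAt, fun s => add_nonneg (hW₁ _ _ _) (hW₂ _ _ _),
    fun s => ?_, fun x y₀ u₀ s K hz hv => ?_⟩
  · intro s'
    obtain ⟨k1, k2, k3, k4, k5⟩ := P.sflcbStep_blocks hf hg δ ⟨ρ₁, ρ₂, ηx, ηy, ηz, ηu, ηv⟩ s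
    have hn : δ * ‖gradient (P.Phiδ δ) s.x‖ = ‖D s.x‖ := by
      rw [(hgrad s.x).gradient, norm_smul, norm_inv, Real.norm_eq_abs, abs_of_pos hδ,
        mul_inv_cancel_left₀ hδ.ne']
    rw [hn]
    have w1 := hs₁ s.x s'.x (pair s.y s.α) s.u
    have w2 := hs₂ s.x s'.x (pair s.z s.β) s.v
    rw [← k1, ← k3] at w1
    rw [← k2, ← k4] at w2
    have d1 := hd₁ s.x (pair s.y s.α) s.u
    have d2 := hd₂ s.x (pair s.z s.β) s.v
    set a := W₁ s.x (pair s.y s.α) s.u with ha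
    set b := W₂ s.x (pair s.z s.β) s.v with hb
    have ha0 : 0 ≤ a := hW₁ _ _ _
    have hb0 : 0 ≤ b := hW₂ _ _ _
    set G₁ := valueGrad B φ s.x (pair s.y s.α).fst
      (s.u + (ηu + ρ₁) • (P.h s.x (pair s.y s.α).fst - (pair s.y s.α).snd)) with hG₁
    set G₂ := valueGrad B P.g s.x (pair s.z s.β).fst
      (s.v + (ηv + ρ₂) • (P.h s.x (pair s.z s.β).fst - (pair s.z s.β).snd)) with hG₂
    have k5' : s'.x - s.x = -(ηx • (G₁ - G₂)) := by
      rw [show s'.x = s.x - ηx • (G₁ - G₂) from k5]; abel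
    have hdist : ‖s'.x - s.x‖ = ηx * ‖G₁ - G₂‖ := by
      rw [k5', norm_neg, norm_smul, Real.norm_eq_abs, abs_of_pos hηx]
    have h1 := (abs_le.1 (henv s.x s'.x)).2
    rw [hdist, k5', inner_neg_right, inner_smul_right] at h1
    rw [norm_sub_rev, hdist] at w1 w2
    have hGD : ‖(G₁ - G₂) - D s.x‖ ^ 2 ≤ 2 * (C₁ * a + C₂ * b) := by
      have e : (G₁ - G₂) - D s.x = (G₁ - valueGrad B φ s.x (yδ s.x) (uδ s.x))
          - (G₂ - valueGrad B P.g s.x (yg s.x) (ug s.x)) := by rw [hD]; simp only []; abel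
      rw [e]
      have h2 := pow_le_pow_left₀ (norm_nonneg _) (norm_sub_le
        (G₁ - valueGrad B φ s.x (yδ s.x) (uδ s.x))
        (G₂ - valueGrad B P.g s.x (yg s.x) (ug s.x))) 2
      have h3 := add_sq_le (a := ‖G₁ - valueGrad B φ s.x (yδ s.x) (uδ s.x)‖)
        (b := ‖G₂ - valueGrad B P.g s.x (yg s.x) (ug s.x)‖)
      linarith
    -- Polarisation writes `-⟨D, G₁ - G₂⟩` as `-‖D‖² / 2 - ‖G₁ - G₂‖² / 2` plus half the squared
    -- error.
    have hexp := norm_sub_sq_real (G₁ - G₂) (D s.x)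
    rw [real_inner_comm] at hexp
    have hCab : C₁ * a + C₂ * b ≤ C * (a + b) := by
      rw [hC]
      linarith [mul_nonneg hC₁.le hb0, mul_nonneg hC₂.le ha0]
    have h4 : ηx * (C₁ * a + C₂ * b) ≤ c * (a + b) := by
      calc ηx * (C₁ * a + C₂ * b) ≤ ηx * (C * (a + b)) := by gcongr
        _ = ηx * C * (a + b) := by ring
        _ ≤ c * (a + b) := by gcongr
    have h5 : (1 - c₁) * a + (1 - c₂) * b ≤ (1 - c) * (a + b) := by
      linarith [mul_le_mul_of_nonneg_right hcc₁ ha0, mul_le_mul_of_nonneg_right hcc₂ hb0]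
    have h6 : ηx * (4 * C) * (ηx / 2 * ‖G₁ - G₂‖ ^ 2) ≤ 1 * (ηx / 2 * ‖G₁ - G₂‖ ^ 2) := by
      gcongr
    have h7 := mul_le_mul_of_nonneg_left hGD (half_pos hηx).le
    rw [hexp] at h7
    have h8 : C₁ * (ηx * ‖G₁ - G₂‖) ^ 2 + C₂ * (ηx * ‖G₁ - G₂‖) ^ 2
        = C * (ηx * ‖G₁ - G₂‖) ^ 2 := by rw [hC]; ring
    change _ + (W₁ s'.x (pair s'.y s'.α) s'.u + W₂ s'.x (pair s'.z s'.β) s'.v)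
      ≤ _ + (a + b) - _
    linarith
  -- The start approximates the KKT pair of `g`; for the `δ f + g` block the gradients differ by `δ
  -- ∇f` at `y₀`, so both blocks start within `O(δ)`.
  · have hN₁ : ‖(gradient φ (pair x y₀)).snd - (gradient P.g (pair x y₀)).snd‖
        ≤ δ * ‖gradient P.f (pair x y₀)‖ := by
      have e : gradient φ (pair x y₀) = _ := gradient_penalised hf hg δ (pair x y₀)
      rw [e]
      have e2 : (δ • gradient P.f (pair x y₀) + gradient P.g (pair x y₀)).snd
          - (gradient P.g (pair x y₀)).snd = δ • (gradient P.f (pair x y₀)).snd :=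
        add_sub_cancel_right _ _
      rw [e2, norm_smul, Real.norm_eq_abs, abs_of_pos hδ]
      gcongr
      exact WithLp.norm_snd_le_norm _
    have hN₂ : ‖(gradient P.g (pair x y₀)).snd - (gradient P.g (pair x y₀)).snd‖
        ≤ δ * ‖gradient P.f (pair x y₀)‖ := by
      rw [sub_self, norm_zero]; positivity
    have h1 := hi₁ P.g x y₀ u₀ s.z s.v δ _ K hN₁ hz hv
    have h2 := hi₂ P.g x y₀ u₀ s.z s.v δ _ K hN₂ hz hv
    change W₁ x (pair s.z (P.h x s.z)) s.v + W₂ x (pair s.z (P.h x s.z)) s.v ≤ _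
    rw [hC]
    linarith

end LinBilevel

/-! ### Iteration counts and the main theorem -/

theorem half_le_log_one_div {ε : ℝ} (hε : 0 < ε) (hε' : ε ≤ 1 / 2) :
    1 / 2 ≤ Real.log (1 / ε) := by
  have h1 : (2 : ℝ) ≤ 1 / ε := by rw [le_div_iff₀ hε]; linarith
  have h2 := Real.log_le_log two_pos h1
  linarith [Real.log_two_gt_d9]

/-- Logarithmically many steps of a linearly convergent method reach accuracy `ε`. -/
theorem exists_log_iterations {E c c₁ : ℝ} (hE : 0 ≤ E) (hc : 0 < c) (hc' : c < 1) (hc₁ : 0 < c₁) :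
    ∃ C₁ : ℝ, 0 < C₁ ∧ ∀ ε : ℝ, 0 < ε → ε ≤ 1 / 2 →
      ∃ n, ⌈C₁ * Real.log (1 / ε)⌉₊ = n + 1 ∧ E * (1 - c) ^ n ≤ (c₁ * ε) ^ 2 := by
  -- The factor `exp c` pays for the exponent `n` where the ceiling is `n + 1`. In the constant
  -- below, `2 |log Q|` suffices because `log (1 / ε) ≥ 1 / 2`.
  obtain ⟨Q, hQ⟩ : ∃ Q, Q = (E + 1) * Real.exp c / c₁ ^ 2 := ⟨_, rfl⟩
  have hQ0 : 0 < Q := by rw [hQ]; positivity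
  refine ⟨(2 + 2 * |Real.log Q|) / c, by positivity, fun ε hε hε' => ?_⟩
  have hl := half_le_log_one_div hε hε'
  have hpos : 0 < (2 + 2 * |Real.log Q|) / c * Real.log (1 / ε) := by
    have : 0 < Real.log (1 / ε) := by linarith
    positivity
  obtain ⟨n, hn⟩ : ∃ n, ⌈(2 + 2 * |Real.log Q|) / c * Real.log (1 / ε)⌉₊ = n + 1 :=
    Nat.exists_eq_add_one_of_ne_zero (Nat.ceil_pos.2 hpos).ne'
  refine ⟨n, hn, ?_⟩
  have h1 : (2 + 2 * |Real.log Q|) / c * Real.log (1 / ε) ≤ n + 1 := by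
    have := Nat.le_ceil ((2 + 2 * |Real.log Q|) / c * Real.log (1 / ε))
    rw [hn] at this
    exact_mod_cast this
  rw [div_mul_eq_mul_div, div_le_iff₀ hc] at h1
  have h2 : 2 * Real.log (1 / ε) + Real.log Q ≤ (n + 1) * c := by
    have h3 : |Real.log Q| * 1 ≤ |Real.log Q| * (2 * Real.log (1 / ε)) := by
      gcongr; linarith
    linarith [le_abs_self (Real.log Q)]
  have h3 : (1 - c) ^ n ≤ Real.exp (-c) ^ n := by
    exact pow_le_pow_left₀ (by linarith) (by linarith [Real.add_one_le_exp (-c)]) n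
  have h4 : Real.exp (-c) ^ n ≤ Real.exp (c - 2 * Real.log (1 / ε) - Real.log Q) := by
    rw [← Real.exp_nat_mul]
    exact Real.exp_le_exp.2 (by linarith)
  have h5 : Real.exp (c - 2 * Real.log (1 / ε) - Real.log Q) = Real.exp c * ε ^ 2 / Q := by
    rw [Real.exp_sub, Real.exp_sub, Real.exp_log hQ0, two_mul, Real.exp_add,
      Real.exp_log (by positivity)]
    field_simp
  calc E * (1 - c) ^ n ≤ (E + 1) * (Real.exp c * ε ^ 2 / Q) := by
        rw [← h5]
        have : 0 ≤ (1 - c) ^ n := pow_nonneg (by linarith) n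
        exact mul_le_mul (by linarith) (h3.trans h4) this (by linarith)
    _ = (c₁ * ε) ^ 2 := by rw [hQ]; field_simp

namespace LinBilevel

variable {dx dy dh : ℕ} {B : Matrix (Fin dh) (Fin dx) ℝ} {A : Matrix (Fin dh) (Fin dy) ℝ}
  {P : LinBilevel B A} {lf0 lf1 lg1 : ℝ≥0} {μg : ℝ}

/-- The penalised hyper-objective is close to the hyper-objective from below. -/
theorem Assumptions.Phi_sub_le_Phiδ (H : P.Assumptions lf0 lf1 lg1 μg) (hμ : 0 < μg) {δ : ℝ}
    (hδ : 0 < δ) {x : Vec dx} {yδ yg : Vec dy} {ug : Vec dh} (hyδ : P.yStarδ δ x = yδ)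
    (hmem : yδ ∈ P.feas x) (hyg : P.yStar x = yg) (K : P.KKT P.g x yg ug) :
    P.Phi x - lf0 ^ 2 * δ / μg ≤ P.Phiδ δ x := by
  have h1 := K.le_of_mem_feas (H.regular_g hμ) hmem
  have h2 := H.lipschitz_f.dist_le_mul (pair x yδ) hmem (pair x yg) K.mem_feas
  rw [Real.dist_eq, dist_eq_norm, pair_sub, sub_self] at h2
  have h3 : ‖pair (0 : Vec dx) (yδ - yg)‖ ≤ ‖yδ - yg‖ := by
    simpa using norm_pair_le (0 : Vec dx) (yδ - yg)
  have h4 := (abs_le.1 h2).1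
  have h5 := mul_le_mul_of_nonneg_left h3 lf0.coe_nonneg
  have h6 : 1 / δ * (μg / 2 / 2 * ‖yδ - yg‖ ^ 2) ≤ 1 / δ * (P.g (pair x yδ) - P.g (pair x yg)) := by
    gcongr
    linarith
  -- Completing the square: quadratic growth of `g` divided by `δ` beats the Lipschitz loss of `f`
  -- up to `l_{f,0}² δ / μ_g`.
  have h7 : 1 / δ * (μg / 2 / 2 * ‖yδ - yg‖ ^ 2) - lf0 * ‖yδ - yg‖ + lf0 ^ 2 * δ / μg
      = (μg * ‖yδ - yg‖ - 2 * lf0 * δ) ^ 2 / (4 * δ * μg) := by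
    field_simp; ring
  have h8 : 0 ≤ (μg * ‖yδ - yg‖ - 2 * lf0 * δ) ^ 2 / (4 * δ * μg) := by positivity
  rw [Phi, Phiδ, hyδ, hyg]
  linarith

theorem Phiδ_le_Phi {δ : ℝ} (hδ : 0 < δ) {x : Vec dx} {yδ yg : Vec dy}
    (hyδ : P.yStarδ δ x = yδ) (hmin : IsMinimizer (P.feas x) (P.gδ δ x) yδ)
    (hyg : P.yStar x = yg) (hmem : yg ∈ P.feas x) : P.Phiδ δ x ≤ P.Phi x := by
  have h1 : P.gδ δ x yδ ≤ P.gδ δ x yg := hmin.2 hmem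
  simp only [gδ] at h1
  rw [Phi, Phiδ, hyδ, hyg]
  refine le_of_mul_le_mul_left ?_ hδ
  rw [mul_add, one_div, mul_inv_cancel_left₀ hδ.ne']
  linarith

end LinBilevel

theorem mainTheorem5 {dx dy dh : ℕ}
    (B : Matrix (Fin dh) (Fin dx) ℝ) (A : Matrix (Fin dh) (Fin dy) ℝ) (hA : A.rank = dh)
    (μg : ℝ) (hμg : 0 < μg) (lf1 lg1 : ℝ≥0)
    (ρ₁ ρ₂ : ℝ) (hρ₁ : 0 < ρ₁) (hρ₁' : ρ₁ * ‖A‖ ^ 2 < μg / 2)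
    (hρ₂ : 0 < ρ₂) (hρ₂' : ρ₂ * ‖A‖ ^ 2 < μg) :
    ∃ τz τv ηx ηy ηz ηu ηv : ℝ,
      0 < τz ∧ 0 < τv ∧ 0 < ηx ∧ 0 < ηy ∧ 0 < ηz ∧ 0 < ηu ∧ 0 < ηv ∧
      ∀ (P : LinBilevel B A) (lf0 : ℝ≥0), P.Assumptions lf0 lf1 lg1 μg →
      ∀ (x₀ : Vec dx) (s₀ : PGDState dy dh), (∀ i, 0 ≤ s₀.v i) →
      ∀ c₁ c₂ : ℝ, 0 < c₁ → c₁ ≤ c₂ →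
      ∃ C₁ C₂ C₃ : ℝ, 0 < C₁ ∧ 0 < C₂ ∧ 0 < C₃ ∧
      ∀ ε δ : ℝ, 0 < ε → ε ≤ 1 / 2 → c₁ * ε ≤ δ → δ ≤ c₂ * ε → 2 * lf1 * δ ≤ μg →
        let N : ℕ := ⌈C₁ * Real.log (1 / ε)⌉₊
        let T : ℕ := ⌈C₂ * (1 / ε) ^ 3⌉₊
        let init : Counted (PGDState dy dh) := P.pgd τz τv x₀ N s₀
        let run : ℕ → Counted (SFLCBState dx dy dh) := fun t =>
          P.sflcb δ ⟨ρ₁, ρ₂, ηx, ηy, ηz, ηu, ηv⟩ t (P.warmStart x₀ init.val)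
        -- the solutions that define `y*`, `y*_δ` and `v*(x₀)` exist and are unique
        (∀ x, ∃! y, IsMinimizer (P.feas x) (fun y => P.g (pair x y)) y) ∧
        (∀ x, ∃! y, IsMinimizer (P.feas x) (P.gδ δ x) y) ∧
        (∃! v, P.IsMultiplier x₀ v) ∧
        -- the projected gradient phase is `δ`-accurate and costs `O(log (1 / ε))`
        ‖init.val.z - P.yStar x₀‖ ≤ δ ∧
        (∀ v, P.IsMultiplier x₀ v → ‖init.val.v - v‖ ≤ δ) ∧
        (init.calls : ℝ) ≤ C₃ * Real.log (1 / ε) ∧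
        -- SFLCB finds an `ε`-stationary point of the differentiable function `Φ_δ`
        Differentiable ℝ (P.Phiδ δ) ∧
        (∃ t < T, ‖gradient (P.Phiδ δ) (run t).val.x‖ ≤ ε) ∧
        -- SFLCB, and both phases together, cost `O(ε⁻³)`
        ((run T).calls : ℝ) ≤ C₃ * (1 / ε) ^ 3 ∧
        ((init.calls + (run T).calls : ℕ) : ℝ) ≤ C₃ * (1 / ε) ^ 3 := by
  have hm : 0 < μg / 2 := by positivity
  have hmL : μg / 2 ≤ lg1 + μg / 2 := by linarith [lg1.coe_nonneg]
  obtain ⟨S, s, -, hS, hs⟩ := exists_rightInverse_of_rank_eq hA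
  obtain ⟨τz, τv, c, hτz, hτv, hc, hc', Hpgd⟩ := LinBilevel.exists_pgd_rate B hA hm hmL
  obtain ⟨ηx, ηy, ηz, ηu, ηv, C, hηx, hηy, hηz, hηu, hηv, hC, Hdec⟩ :=
    LinBilevel.exists_sflcb_decrease B hA hμg lf1 lg1 hρ₁ hρ₂
  refine ⟨τz, τv, ηx, ηy, ηz, ηu, ηv, hτz, hτv, hηx, hηy, hηz, hηu, hηv,
    fun P lf0 H x₀ s₀ _ c₁ c₂ hc₁ hc₁₂ => ?_⟩
  have Rg := H.regular_g hμg
  have hc₂ : 0 < c₂ := hc₁.trans_le hc₁₂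
  obtain ⟨y₀, u₀, K₀, Hs⟩ := Hpgd P Rg x₀
  obtain ⟨E, hE, hEn⟩ := Hs s₀
  obtain ⟨C₁, hC₁, HC₁⟩ := exists_log_iterations hE hc hc' hc₁
  obtain ⟨b, hb⟩ := H.bddBelow_Phi
  replace hb : ∀ x, b ≤ P.Phi x := fun x => hb ⟨x, rfl⟩
  -- `δ Q` bounds the total possible drop of the potential for every admissible `δ`, using `δ ≤ c₂`.
  obtain ⟨Q, hQ⟩ : ∃ Q, Q = P.Phi x₀ - b + lf0 ^ 2 * c₂ / μg
    + C * (1 + ‖gradient P.f (pair x₀ y₀)‖) ^ 2 * c₂ := ⟨_, rfl⟩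
  have hQ0 : 0 ≤ Q := by
    have h1 := hb x₀
    have h2 : 0 ≤ (lf0 : ℝ) ^ 2 * c₂ / μg := by positivity
    have h3 : 0 ≤ C * (1 + ‖gradient P.f (pair x₀ y₀)‖) ^ 2 * c₂ := by positivity
    linarith
  obtain ⟨C₂, hC₂⟩ : ∃ C₂, C₂ = 2 * (Q + 1) / (ηx * c₁) := ⟨_, rfl⟩
  have hC₂0 : 0 < C₂ := by rw [hC₂]; positivity
  refine ⟨C₁, C₂, C₁ + 2 + 3 * (C₂ + 1), hC₁, hC₂0, by positivity,
    fun ε δ hε hε' hδ₁ hδ₂ hδ' => ?_⟩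
  intro N T init run
  have hδ : 0 < δ := lt_of_lt_of_le (by positivity) hδ₁
  have hδc : δ ≤ c₂ := hδ₂.trans (by nlinarith)
  obtain ⟨yδ, yg, uδ, ug, W, Kδ, Kg, hdiff, hW0, hWstep, hWinit⟩ := Hdec P lf0 H δ hδ hδ'
  have Rδ := H.regular_penalised hδ.le hδ'
  have hyδ : ∀ x, P.yStarδ δ x = yδ x := fun x => (Kδ x).argminOn_eq Rδ hm
  have hyg : ∀ x, P.yStar x = yg x := fun x => (Kg x).argminOn_eq Rg hm
  have hy₀ : P.yStar x₀ = y₀ := K₀.argminOn_eq Rg hm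
  have hmult : ∀ v, P.IsMultiplier x₀ v ↔ v = u₀ := fun v => K₀.isMultiplier_iff Rg hm hS hs
  obtain ⟨n, hn, hEε⟩ := HC₁ ε hε hε'
  have hacc : ‖init.val.z - y₀‖ ≤ δ ∧ ‖init.val.v - u₀‖ ≤ δ := by
    have e : init = P.pgd τz τv x₀ (n + 1) s₀ := by simp only [init, N, hn]
    rw [e]
    have h1 : (c₁ * ε) ^ 2 ≤ δ ^ 2 := pow_le_pow_left₀ (by positivity) hδ₁ 2
    exact ⟨le_of_sq_le_sq (((hEn n).1.trans hEε).trans h1) hδ.le,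
      le_of_sq_le_sq (((hEn n).2.trans hEε).trans h1) hδ.le⟩
  have hlog := half_le_log_one_div hε hε'
  have hlog3 : Real.log (1 / ε) ≤ (1 / ε) ^ 3 := by
    have h1 : Real.log (1 / ε) ≤ 1 / ε := (Real.log_le_sub_one_of_pos (by positivity)).trans
      (by linarith)
    have h2 : 1 ≤ 1 / ε := by rw [le_div_iff₀ hε]; linarith
    exact h1.trans (le_self_pow₀ h2 (by norm_num))
  have hone : 1 ≤ (1 / ε) ^ 3 := one_le_pow₀ (by rw [le_div_iff₀ hε]; linarith)
  -- The `+ 1` from the ceiling is at most `2 log (1 / ε)`.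
  have hcalls₁ : (init.calls : ℝ) ≤ (C₁ + 2) * Real.log (1 / ε) := by
    have h1 : init.calls = 1 * N := Counted.iterate_calls (P.pgdStep_calls τz τv x₀) N s₀
    have h2 := (Nat.ceil_lt_add_one (a := C₁ * Real.log (1 / ε)) (by positivity)).le
    rw [h1, one_mul]
    linarith
  have hcalls₂ : ((run T).calls : ℝ) ≤ 3 * (C₂ + 1) * (1 / ε) ^ 3 := by
    have h1 : (run T).calls = 3 * T := Counted.iterate_calls (P.sflcbStep_calls δ _) T _
    have h2 := (Nat.ceil_lt_add_one (a := C₂ * (1 / ε) ^ 3) (by positivity)).le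
    rw [h1]
    push_cast
    linarith
  refine ⟨fun x => (Kg x).existsUnique_isMinimizer Rg hm,
    fun x => (Kδ x).existsUnique_isMinimizer Rδ hm,
    ⟨u₀, (hmult u₀).2 rfl, fun v hv => (hmult v).1 hv⟩, by rw [hy₀]; exact hacc.1,
    fun v hv => by rw [(hmult v).1 hv]; exact hacc.2, ?_, hdiff, ?_, ?_, ?_⟩
  · exact hcalls₁.trans (mul_le_mul_of_nonneg_right (by linarith) (by linarith))
  · by_contra! hcon
    have hdescent : ∀ k ≤ T, δ * P.Phiδ δ (run k).val.x + W (run k).val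
        ≤ δ * P.Phiδ δ x₀ + W (P.warmStart x₀ init.val) - k * (ηx / 2 * (δ * ε) ^ 2) := by
      intro k
      induction k with
      | zero =>
        intro _
        rw [Nat.cast_zero, zero_mul, sub_zero]
        rfl
      | succ k ih =>
        intro hk
        have h1 := ih (Nat.le_of_succ_le hk)
        have h2 := hWstep (run k).val
        have h3 := hcon k hk
        have h4 : ηx / 2 * (δ * ε) ^ 2
            ≤ ηx / 2 * (δ * ‖gradient (P.Phiδ δ) (run k).val.x‖) ^ 2 := by gcongr
        push_cast
        change δ * P.Phiδ δ (run (k + 1)).val.x + W (run (k + 1)).val ≤ _ at h2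
        linarith
    have h1 := hdescent T le_rfl
    have h2 := hWinit x₀ y₀ u₀ init.val K₀ hacc.1 hacc.2
    have h3 := hW0 (run T).val
    have h4 := H.Phi_sub_le_Phiδ hμg hδ (hyδ (run T).val.x) (Kδ _).mem_feas (hyg _) (Kg _)
    have h5 : P.Phiδ δ x₀ ≤ P.Phi x₀ :=
      LinBilevel.Phiδ_le_Phi hδ (hyδ x₀) ((Kδ x₀).isMinimizer Rδ hm) (hyg x₀) (Kg x₀).mem_feas
    have h6 : (lf0 : ℝ) ^ 2 * δ / μg ≤ lf0 ^ 2 * c₂ / μg := by gcongr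
    have h7 : δ * (b - lf0 ^ 2 * c₂ / μg) ≤ δ * P.Phiδ δ (run T).val.x := by
      gcongr
      linarith [hb (run T).val.x]
    have h8 : δ * P.Phiδ δ x₀ ≤ δ * P.Phi x₀ := by gcongr
    have h9 : C * (1 + ‖gradient P.f (pair x₀ y₀)‖) ^ 2 * δ ^ 2
        ≤ δ * (C * (1 + ‖gradient P.f (pair x₀ y₀)‖) ^ 2 * c₂) := by
      rw [sq δ, ← mul_assoc, mul_comm _ δ]
      gcongr
    have h10 : (T : ℝ) * (ηx / 2 * (δ * ε) ^ 2) ≤ δ * Q := by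
      rw [hQ]
      linarith
    have h11 : C₂ * (1 / ε) ^ 3 ≤ T := Nat.le_ceil _
    -- One factor of `δ²` is kept to cancel against `δ Q`, the other is bounded below by `c₁ ε`.
    -- With the chosen `C₂` the left side equals `δ (Q + 1)`, a contradiction.
    have h12 : C₂ * (1 / ε) ^ 3 * (ηx / 2 * (δ * (c₁ * ε) * ε ^ 2)) ≤ δ * Q := by
      refine le_trans ?_ h10
      have e : (δ * ε) ^ 2 = δ * δ * ε ^ 2 := by ring
      rw [e]
      gcongr
    have h13 : C₂ * (1 / ε) ^ 3 * (ηx / 2 * (δ * (c₁ * ε) * ε ^ 2)) = δ * (Q + 1) := by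
      rw [hC₂]; field_simp
    rw [h13] at h12
    linarith [le_of_mul_le_mul_left h12 hδ]
  · exact hcalls₂.trans (mul_le_mul_of_nonneg_right (by linarith) (by linarith))
  · push_cast
    have h1 : (C₁ + 2) * Real.log (1 / ε) ≤ (C₁ + 2) * (1 / ε) ^ 3 := by gcongr
    linarith
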